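/- **(Nonlinear extension of the Brunn–Minkowski inequality.)** For $s\in[-\infty,+\infty]$, $\lambda\in[0,1]$ and $a,b\in[0,+\infty]$ let $$M_s^\lambda(a,b)=\big((1-\lambda)a^s+\lambda b^s\big)^{1/s}\quad (s\notin\{-\infty,0,+\infty\}),$$ $M_{-\infty}^\lambda(a,b)=\min(a,b)$, $M_0^\lambda(a,b)=a^{1-\lambda}b^\lambda$, $M_{+\infty}^\lambda(a,b)=\max(a,b)$, with the conventions $0^s=\infty$, $\infty^s=0$ for $s<0$, $0^0=\infty^0=1$ and $0\cdot\infty=0$. For ${\bf p}\in[0,1]^n$ and $x,y\in[0,+\infty)^n$ let $M_{\bf p}^\lambda(x,y)=(M_{p_1}^\lambda(x_1,y_1),\dots,M_{p_n}^\lambda(x_n,y_n))$. Let $n\ge 1$, ${\bf p}=(p_1,\dots,p_n)\in[0,1]^n$, $\lambda\in[0,1]$, and let $\gamma\in(-\infty,+\infty]$ satisfy $\gamma\ge-\big(\sum_{i=1}^n p_i^{-1}\big)^{-1}$ (where $0^{-1}=+\infty$ and $(+\infty)^{-1}=0$). Let $f,g,h:[0,+\infty)^n\to[0,+\infty)$ be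 Lebesgue measurable functions, where neither $f$ nor $g$ is identically zero. If $$h(M_{\bf p}^\lambda(x,y))\ \ge\ M_\gamma^\lambda(f(x),g(y))$$ for all $x,y\in[0,+\infty)^n$ with $f(x)>0$ and $g(y)>0$, then $$\int_{[0,+\infty)^n}h\ \ge\ M^\lambda_{\left(\sum_{i=1}^n p_i^{-1}+\gamma^{-1}\right)^{-1}}\left(\int_{[0,+\infty)^n}f,\ \int_{[0,+\infty)^n}g\right),$$ where the integrals, with respect to Lebesgue measure, may be $+\infty$, and the exponent $\left(\sum_i p_i^{-1}+\gamma^{-1}\right)^{-1}$ is understood as $0$ if some $p_i=0$ or $\gamma=0$, as $-\infty$ if $\gamma=-\big(\sum_i p_i^{-1}\big)^{-1}<0$, and with $\gamma^{-1}=0$ if $\gamma=+\infty$. -/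

import Mathlib

open MeasureTheory
open scoped ENNReal NNReal

/-- The `s`-mean `M_s^l(a,b)` of `a, b ∈ [0,∞]` with weight `l ∈ [0,1]`, for `s ∈ [-∞,∞]`.
The powers and products are those of `[0,∞]`: `0 ^ s = ∞` and `∞ ^ s = 0` for `s < 0`, `0 * ∞ = 0`.
So for `s < 0` and `0 < l < 1` the mean vanishes as soon as `a = 0` or `b = 0`, and for real `s` the
mean is `a` when `l = 0` and `b` when `l = 1`. -/
noncomputable def powerMean (s : EReal) (l : ℝ) (a b : ℝ≥0∞) : ℝ≥0∞ :=
  if s = ⊥ then min a b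
  else if s = ⊤ then max a b
  else if s = 0 then a ^ (1 - l) * b ^ l
  else (ENNReal.ofReal (1 - l) * a ^ s.toReal + ENNReal.ofReal l * b ^ s.toReal) ^ (1 / s.toReal)

/-- Means of finite numbers are finite. -/
theorem powerMean_ne_top (s : EReal) {l : ℝ} (hl : l ∈ Set.Icc (0 : ℝ) 1) (a b : ℝ≥0) :
    powerMean s l a b ≠ ⊤ := by
  obtain ⟨h0, h1⟩ := hl
  unfold powerMean
  split_ifs with hbot htop hzero
  · simp
  · simp
  · exact ENNReal.mul_ne_top (ENNReal.rpow_ne_top_of_nonneg (by linarith) ENNReal.coe_ne_top)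
      (ENNReal.rpow_ne_top_of_nonneg h0 ENNReal.coe_ne_top)
  · have hs : s.toReal ≠ 0 := by
      intro h
      exact (EReal.toReal_eq_zero_iff.1 h).elim hzero (fun h => h.elim htop hbot)
    rcases lt_or_gt_of_ne hs with hneg | hpos
    · have ha : (a : ℝ≥0∞) ^ s.toReal ≠ 0 := by simp [ENNReal.rpow_eq_zero_iff, hneg.le]
      have hb : (b : ℝ≥0∞) ^ s.toReal ≠ 0 := by simp [ENNReal.rpow_eq_zero_iff, hneg.le]
      intro h
      rcases ENNReal.rpow_eq_top_iff.1 h with ⟨h, -⟩ | ⟨-, h⟩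
      · simp only [add_eq_zero, mul_eq_zero, ha, hb, or_false, ENNReal.ofReal_eq_zero] at h
        linarith [h.1, h.2]
      · exact absurd h (not_lt.2 (one_div_neg.2 hneg).le)
    · refine ENNReal.rpow_ne_top_of_nonneg (by positivity) (ENNReal.add_ne_top.2 ⟨?_, ?_⟩) <;>
        exact ENNReal.mul_ne_top ENNReal.ofReal_ne_top
          (ENNReal.rpow_ne_top_of_nonneg hpos.le ENNReal.coe_ne_top)

/-- The coordinatewise mean `M_p^l(x,y) = (M_{p_1}^l(x_1,y_1), …, M_{p_n}^l(x_n,y_n))` of two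
points of `[0,∞)ⁿ`; the truncation `toNNReal` changes nothing for `l ∈ [0,1]`, by
`powerMean_ne_top`. -/
noncomputable def vecMean {n : ℕ} (p : Fin n → ℝ≥0) (l : ℝ) (x y : Fin n → ℝ≥0) : Fin n → ℝ≥0 :=
  fun i => (powerMean ((p i : ℝ) : EReal) l (x i) (y i)).toNNReal

/-- The sum `∑ p_i⁻¹ ∈ [0,∞]`, where `0⁻¹ = ∞`. -/
noncomputable def sumInv {n : ℕ} (p : Fin n → ℝ≥0) : ℝ≥0∞ := ∑ i, (p i : ℝ≥0∞)⁻¹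

/-- The exponent `(S + γ⁻¹)⁻¹` for `S ∈ (0,∞]` and `γ ≥ -S⁻¹`, extended by continuity to the
degenerate cases: it is `0` if `S = ∞` or `γ = 0`, and `-∞` if `γ = -S⁻¹ < 0`. If `γ = ∞`,
then `γ⁻¹ = 0`. -/
noncomputable def combinedExponent (S : ℝ≥0∞) (γ : EReal) : EReal :=
  if S = ⊤ ∨ γ = 0 then 0
  else if γ = -((S⁻¹ : ℝ≥0∞) : EReal) then ⊥
  else ((S : EReal) + γ⁻¹)⁻¹

/-- Lebesgue measure on `[0,∞)ⁿ`: the measure of a set `A` is the `n`-dimensional Lebesgue measure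
of `A` as a subset of `ℝⁿ`. -/
noncomputable def orthantVolume (n : ℕ) : Measure (Fin n → ℝ≥0) :=
  Measure.comap (fun x i => (x i : ℝ)) (volume : Measure (Fin n → ℝ))

/-- The map `[0,∞)ⁿ → ℝⁿ` is a measurable embedding, so that `orthantVolume` is the intended
measure. -/
theorem measurableEmbedding_orthant (n : ℕ) :
    MeasurableEmbedding (fun (x : Fin n → ℝ≥0) (i : Fin n) => (x i : ℝ)) := by
  have hc : Topology.IsClosedEmbedding (fun (x : Fin n → ℝ≥0) (i : Fin n) => (x i : ℝ)) := by
    refine ⟨⟨Topology.IsInducing.piMap (fun _ => NNReal.isEmbedding_coe.isInducing), ?_⟩, ?_⟩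
    · intro x y hxy
      funext i
      exact NNReal.coe_injective (congrFun hxy i)
    · have : Set.range (fun (x : Fin n → ℝ≥0) (i : Fin n) => (x i : ℝ)) = Set.Ici 0 := by
        ext z
        constructor
        · rintro ⟨x, rfl⟩ i
          exact (x i).2
        · intro hz
          exact ⟨fun i => ⟨z i, hz i⟩, rfl⟩
      rw [this]
      exact isClosed_Ici
  exact hc.measurableEmbedding

/-- Integration over `[0,∞)ⁿ` is integration over the nonnegative orthant of `ℝⁿ`. -/
theorem lintegral_orthantVolume (n : ℕ) (F : (Fin n → ℝ) → ℝ≥0∞) :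
    ∫⁻ x, F (fun i => (x i : ℝ)) ∂(orthantVolume n) = ∫⁻ x in Set.Ici (0 : Fin n → ℝ), F x := by
  have hr : Set.range (fun (x : Fin n → ℝ≥0) (i : Fin n) => (x i : ℝ)) = Set.Ici 0 := by
    ext z
    constructor
    · rintro ⟨x, rfl⟩ i
      exact (x i).2
    · intro hz
      exact ⟨fun i => ⟨z i, hz i⟩, rfl⟩
  have he := measurableEmbedding_orthant n
  rw [← hr, ← he.map_comap, he.lintegral_map, orthantVolume]

/-! The proof is by induction on the dimension; each coordinate changes the exponent by a map `φ_T :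
γ ↦ γ / (1 + T γ)`, that is, by adding `T` to `1/γ`. These maps satisfy `φ_S ∘ φ_T = φ_{S+T}`
(`shiftExponent_add`). For fixed first coordinates the induction hypothesis bounds the integrals
over the slices, with exponent `φ_T γ` where `T` is the sum over the remaining coordinates; the
inequality on `[0,∞)` for `q = p_0` then applies `φ_{1/q}`.

On `[0,∞)` the substitution `x = u^{1/q}` turns `M_q` into the arithmetic mean. Hölder's inequality
for means, `M_{φ_s γ}(ac, bd) ≤ M_γ(a,b) M_{1/s}(c,d)` (`powerMean_mul_le`), absorbs the Jacobian at
the cost of `φ_{1/q-1}`, and the Borell–Brascamp–Lieb inequality on `ℝ` contributes `φ_1`. For `q =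
0` the substitution is `x = e^u`.

On `ℝ`, bounded `f` and `g` are divided by their suprema `a`, `b`, and `h` by `C = M_δ(a,b)`. A
convex combination of the level sets of `f/a` and `g/b` at height `t` lies in that of `h/C`, so
one-dimensional Brunn–Minkowski and integration over `t` give `C M_1(∫ f/a, ∫ g/b) ≤ ∫ h`. Hölder
with `s = 1` bounds the left side below by `M_{φ_1 δ}(∫ f, ∫ g)`.

For positive exponents a mean need not vanish with one argument, so functions that vanish almost
everywhere still matter. The auxiliary inequalities therefore carry arbitrary nonempty sets `A`, `B`
containing the supports; such sets, unlike nonvanishing integrals, survive slicing and changes on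
null sets. -/

/-! ### Elementary properties of power means -/

theorem powerMean_bot (l : ℝ) (a b : ℝ≥0∞) : powerMean ⊥ l a b = min a b := by
  simp [powerMean]

theorem powerMean_top (l : ℝ) (a b : ℝ≥0∞) : powerMean ⊤ l a b = max a b := by
  simp [powerMean]

theorem powerMean_zero (l : ℝ) (a b : ℝ≥0∞) : powerMean 0 l a b = a ^ (1 - l) * b ^ l := by
  simp [powerMean]

theorem powerMean_coe {r : ℝ} (hr : r ≠ 0) (l : ℝ) (a b : ℝ≥0∞) :
    powerMean (r : EReal) l a b =
      (ENNReal.ofReal (1 - l) * a ^ r + ENNReal.ofReal l * b ^ r) ^ (1 / r) := by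
  simp [powerMean, hr]

theorem ENNReal.rpow_le_rpow_of_nonpos {r : ℝ} (hr : r ≤ 0) {a b : ℝ≥0∞} (h : a ≤ b) :
    b ^ r ≤ a ^ r := by
  have := ENNReal.inv_le_inv.2 (ENNReal.rpow_le_rpow h (neg_nonneg.2 hr))
  simpa only [← ENNReal.rpow_neg, neg_neg] using this

/-- The power mean is monotone in both arguments. -/
theorem powerMean_mono (s : EReal) {l : ℝ} (hl : l ∈ Set.Icc (0 : ℝ) 1) {a b a' b' : ℝ≥0∞}
    (ha : a ≤ a') (hb : b ≤ b') : powerMean s l a b ≤ powerMean s l a' b' := by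
  obtain ⟨h0, h1⟩ := hl
  induction s with
  | bot => rw [powerMean_bot, powerMean_bot]; exact min_le_min ha hb
  | top => rw [powerMean_top, powerMean_top]; exact max_le_max ha hb
  | coe r =>
    rcases lt_trichotomy r 0 with hr | rfl | hr
    · rw [powerMean_coe hr.ne, powerMean_coe hr.ne]
      have h2 : (1 / r) ≤ 0 := (one_div_neg.2 hr).le
      apply ENNReal.rpow_le_rpow_of_nonpos h2
      have ha' := ENNReal.rpow_le_rpow_of_nonpos hr.le ha
      have hb' := ENNReal.rpow_le_rpow_of_nonpos hr.le hb
      gcongr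
    · rw [EReal.coe_zero, powerMean_zero, powerMean_zero]
      have : 0 ≤ 1 - l := by linarith
      gcongr
    · rw [powerMean_coe hr.ne', powerMean_coe hr.ne']
      gcongr

/-- The power mean is positively homogeneous. -/
theorem powerMean_mul_left (s : EReal) {l : ℝ} (hl : l ∈ Set.Icc (0 : ℝ) 1) {t : ℝ≥0∞}
    (ht : t ≠ 0) (ht' : t ≠ ⊤) (a b : ℝ≥0∞) :
    powerMean s l (t * a) (t * b) = t * powerMean s l a b := by
  obtain ⟨h0, h1⟩ := hl
  induction s with
  | bot => simp only [powerMean_bot]; exact (mul_min t a b).symm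
  | top => simp only [powerMean_top]; exact (mul_max t a b).symm
  | coe r =>
    rcases eq_or_ne r 0 with rfl | hr
    · rw [EReal.coe_zero, powerMean_zero, powerMean_zero,
        ENNReal.mul_rpow_of_nonneg _ _ (by linarith), ENNReal.mul_rpow_of_nonneg _ _ h0,
        mul_mul_mul_comm, ← ENNReal.rpow_add _ _ ht ht']
      simp
    · rw [powerMean_coe hr, powerMean_coe hr]
      have key : ∀ c : ℝ≥0∞, (t * c) ^ r = t ^ r * c ^ r := fun c => by
        rcases lt_or_ge r 0 with h | h
        · rw [ENNReal.mul_rpow_eq_ite, if_neg]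
          rintro ⟨h, -⟩
          rcases h with ⟨h, -⟩ | ⟨h, -⟩
          · exact ht h
          · exact ht' h
        · exact ENNReal.mul_rpow_of_nonneg _ _ h
      have ht1 : t ^ r ≠ 0 := by simp [ENNReal.rpow_eq_zero_iff, ht, ht']
      have ht2 : t ^ r ≠ ⊤ := by simp [ENNReal.rpow_eq_top_iff, ht, ht']
      rw [key, key, mul_left_comm, mul_left_comm (ENNReal.ofReal l), ← mul_add,
        ENNReal.mul_rpow_eq_ite, if_neg, ← ENNReal.rpow_mul, mul_one_div_cancel hr,
        ENNReal.rpow_one]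
      rintro ⟨h, -⟩
      rcases h with ⟨h, -⟩ | ⟨h, -⟩
      · exact ht1 h
      · exact ht2 h

/-- Means with opposite exponents are related by inversion. -/
theorem powerMean_neg {s : EReal} (hs : s ≠ 0) (l : ℝ) (a b : ℝ≥0∞) :
    powerMean (-s) l a b = (powerMean s l a⁻¹ b⁻¹)⁻¹ := by
  induction s with
  | bot =>
    rw [EReal.neg_bot, powerMean_top, powerMean_bot, ← inv_inj, inv_inv]
    exact ENNReal.inv_strictAnti.antitone.map_max
  | top =>
    rw [EReal.neg_top, powerMean_bot, powerMean_top, ← inv_inj, inv_inv]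
    exact ENNReal.inv_strictAnti.antitone.map_min
  | coe r =>
    have hr : r ≠ 0 := by rintro rfl; exact hs rfl
    rw [← EReal.coe_neg, powerMean_coe (neg_ne_zero.2 hr), powerMean_coe hr]
    simp only [ENNReal.inv_rpow, ENNReal.rpow_neg, one_div, inv_neg]

/-- For exponents `s ≤ 0` the mean vanishes with its first argument. -/
theorem powerMean_zero_left {s : EReal} (hs : s ≤ 0) {l : ℝ} (hl : l ∈ Set.Ioo (0 : ℝ) 1)
    (b : ℝ≥0∞) : powerMean s l 0 b = 0 := by
  obtain ⟨h0, h1⟩ := hl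
  induction s with
  | bot => simp [powerMean_bot]
  | top => simp at hs
  | coe r =>
    have hr : r ≤ 0 := by exact_mod_cast hs
    rcases hr.eq_or_lt with rfl | hr
    · rw [EReal.coe_zero, powerMean_zero, ENNReal.zero_rpow_of_pos (by linarith), zero_mul]
    · rw [powerMean_coe hr.ne, ENNReal.zero_rpow_of_neg hr, ENNReal.mul_top (by simpa using h1),
        top_add, ENNReal.top_rpow_of_neg (one_div_neg.2 hr)]

/-- For exponents `s ≤ 0` the mean vanishes with its second argument. -/
theorem powerMean_zero_right {s : EReal} (hs : s ≤ 0) {l : ℝ} (hl : l ∈ Set.Ioo (0 : ℝ) 1)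
    (a : ℝ≥0∞) : powerMean s l a 0 = 0 := by
  obtain ⟨h0, h1⟩ := hl
  induction s with
  | bot => simp [powerMean_bot]
  | top => simp at hs
  | coe r =>
    have hr : r ≤ 0 := by exact_mod_cast hs
    rcases hr.eq_or_lt with rfl | hr
    · rw [EReal.coe_zero, powerMean_zero, ENNReal.zero_rpow_of_pos h0, mul_zero]
    · rw [powerMean_coe hr.ne, ENNReal.zero_rpow_of_neg hr, ENNReal.mul_top (by simpa using h0),
        add_top, ENNReal.top_rpow_of_neg (one_div_neg.2 hr)]

open Filter Topology in
/-- The power mean commutes with increasing limits. -/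
theorem powerMean_iSup (s : EReal) {l : ℝ} (hl : l ∈ Set.Ioo (0 : ℝ) 1) {a b : ℕ → ℝ≥0∞}
    (ha : Monotone a) (hb : Monotone b) :
    powerMean s l (⨆ n, a n) (⨆ n, b n) = ⨆ n, powerMean s l (a n) (b n) := by
  have hl' : l ∈ Set.Icc (0 : ℝ) 1 := ⟨hl.1.le, hl.2.le⟩
  have hmono : Monotone fun n => powerMean s l (a n) (b n) :=
    fun i j h => powerMean_mono s hl' (ha h) (hb h)
  refine tendsto_nhds_unique ?_ (tendsto_atTop_iSup hmono)
  have ta := tendsto_atTop_iSup ha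
  have tb := tendsto_atTop_iSup hb
  induction s with
  | bot => simp only [powerMean_bot]; exact ta.min tb
  | top => simp only [powerMean_top]; exact ta.max tb
  | coe r =>
    rcases eq_or_ne r 0 with rfl | hr
    · simp only [EReal.coe_zero, powerMean_zero]
      -- Multiplication on `[0,∞]` is discontinuous at `(0,∞)`, so zero suprema are treated
      -- separately.
      by_cases h0 : (⨆ n, a n) = 0
      · have : ∀ n, a n = 0 := by simpa using h0
        have h1 : 0 < 1 - l := by linarith [hl.2]
        simp [this, ENNReal.zero_rpow_of_pos h1]
      by_cases h0' : (⨆ n, b n) = 0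
      · have : ∀ n, b n = 0 := by simpa using h0'
        simp [this, ENNReal.zero_rpow_of_pos hl.1]
      have h1 : 0 < 1 - l := by linarith [hl.2]
      refine ENNReal.Tendsto.mul ((ENNReal.continuous_rpow_const.tendsto _).comp ta) (Or.inl ?_)
        ((ENNReal.continuous_rpow_const.tendsto _).comp tb) (Or.inl ?_)
      · simp only [ne_eq, ENNReal.rpow_eq_zero_iff, not_or, not_and]
        exact ⟨fun h => absurd h h0, fun _ => by linarith⟩
      · simp only [ne_eq, ENNReal.rpow_eq_zero_iff, not_or, not_and]
        exact ⟨fun h => absurd h h0', fun _ => by linarith [hl.1]⟩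
    · simp only [powerMean_coe hr]
      refine (ENNReal.continuous_rpow_const.tendsto _).comp (Tendsto.add ?_ ?_)
      · exact ENNReal.Tendsto.const_mul ((ENNReal.continuous_rpow_const.tendsto _).comp ta)
          (Or.inr ENNReal.ofReal_ne_top)
      · exact ENNReal.Tendsto.const_mul ((ENNReal.continuous_rpow_const.tendsto _).comp tb)
          (Or.inr ENNReal.ofReal_ne_top)

/-! ### Hölder's inequality for power means and the exponent shift -/

/-- Hölder's inequality for power means with positive exponents. -/
theorem weighted_holder {k t r : ℝ} (hk : 0 < k) (ht : 0 < t) (hr : 0 < r)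
    (h : 1 / k = 1 / t + 1 / r) (w z a b c d : ℝ≥0∞) :
    (w * (a * c) ^ k + z * (b * d) ^ k) ^ (1 / k) ≤
      (w * a ^ t + z * b ^ t) ^ (1 / t) * (w * c ^ r + z * d ^ r) ^ (1 / r) := by
  have hpq : (t / k).HolderConjugate (r / k) := by
    rw [Real.holderConjugate_iff]
    have e : (t / k)⁻¹ + (r / k)⁻¹ = 1 := by
      have : (t / k)⁻¹ + (r / k)⁻¹ = k * (1 / t + 1 / r) := by field_simp
      rw [this, ← h]; field_simp
    refine ⟨?_, e⟩
    have h1 : 0 < (r / k)⁻¹ := by positivity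
    exact (inv_lt_one₀ (by positivity)).1 (by linarith)
  -- Each weight is split as `w = w^{k/t} w^{k/r}` between the two factors.
  have key := ENNReal.inner_le_Lp_mul_Lq Finset.univ
    ![w ^ (1 / (t / k)) * a ^ k, z ^ (1 / (t / k)) * b ^ k]
    ![w ^ (1 / (r / k)) * c ^ k, z ^ (1 / (r / k)) * d ^ k] hpq
  simp only [Fin.sum_univ_two, Matrix.cons_val_zero, Matrix.cons_val_one] at key
  have e1 : ∀ u v : ℝ≥0∞, (u ^ (1 / (t / k)) * v ^ k) ^ (t / k) = u * v ^ t := fun u v => by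
    rw [ENNReal.mul_rpow_of_nonneg _ _ (by positivity), ← ENNReal.rpow_mul, ← ENNReal.rpow_mul,
      one_div_mul_cancel (by positivity), mul_div_cancel₀ _ hk.ne', ENNReal.rpow_one]
  have e2 : ∀ u v : ℝ≥0∞, (u ^ (1 / (r / k)) * v ^ k) ^ (r / k) = u * v ^ r := fun u v => by
    rw [ENNReal.mul_rpow_of_nonneg _ _ (by positivity), ← ENNReal.rpow_mul, ← ENNReal.rpow_mul,
      one_div_mul_cancel (by positivity), mul_div_cancel₀ _ hk.ne', ENNReal.rpow_one]
  have e3 : ∀ u v v' : ℝ≥0∞, u ^ (1 / (t / k)) * v ^ k * (u ^ (1 / (r / k)) * v' ^ k) =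
      u * (v * v') ^ k := fun u v v' => by
    rw [mul_mul_mul_comm, ← ENNReal.rpow_add_of_nonneg _ _ (by positivity) (by positivity),
      ENNReal.mul_rpow_of_nonneg _ _ hk.le]
    have : 1 / (t / k) + 1 / (r / k) = 1 := by simpa using hpq.inv_add_inv_eq_one
    rw [this, ENNReal.rpow_one]
  simp only [e1, e2, e3] at key
  have key2 := ENNReal.rpow_le_rpow key (show 0 ≤ 1 / k by positivity)
  refine key2.trans_eq ?_
  rw [ENNReal.mul_rpow_of_nonneg _ _ (by positivity), ← ENNReal.rpow_mul, ← ENNReal.rpow_mul]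
  congr 2 <;> field_simp

/-- The geometric mean is at most every power mean with exponent `γ ≥ 0`. -/
theorem powerMean_zero_le {γ : EReal} (hγ : 0 ≤ γ) {l : ℝ} (hl : l ∈ Set.Icc (0 : ℝ) 1)
    (a b : ℝ≥0∞) : powerMean 0 l a b ≤ powerMean γ l a b := by
  obtain ⟨h0, h1⟩ := hl
  have h1' : 0 ≤ 1 - l := by linarith
  induction γ with
  | bot => simp at hγ
  | top =>
    rw [powerMean_zero, powerMean_top]
    calc a ^ (1 - l) * b ^ l ≤ max a b ^ (1 - l) * max a b ^ l := by
          gcongr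
          · exact le_max_left _ _
          · exact le_max_right _ _
      _ = max a b := by
          rw [← ENNReal.rpow_add_of_nonneg _ _ h1' h0]; simp
  | coe r =>
    have hr : 0 ≤ r := by exact_mod_cast hγ
    rcases hr.eq_or_lt with rfl | hr
    · simp
    rw [powerMean_zero, powerMean_coe hr.ne']
    rcases h0.eq_or_lt with rfl | h0
    · simp [← ENNReal.rpow_mul, hr.ne']
    rcases h1.eq_or_lt with rfl | h1
    · simp [← ENNReal.rpow_mul, hr.ne']
    have hpq : (1 / (1 - l)).HolderConjugate (1 / l) := by
      rw [Real.holderConjugate_iff]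
      refine ⟨(one_lt_div (by linarith)).2 (by linarith), by simp⟩
    -- With these conjugate exponents Young's inequality is the weighted AM–GM inequality for `a^r`
    -- and `b^r`.
    have := ENNReal.young_inequality (a ^ (r * (1 - l))) (b ^ (r * l)) hpq
    have e : ∀ x : ℝ≥0∞, ∀ m : ℝ, 0 < m → (x ^ (r * m)) ^ (1 / m) / ENNReal.ofReal (1 / m) =
        ENNReal.ofReal m * x ^ r := fun x m hm => by
      rw [← ENNReal.rpow_mul, mul_assoc, mul_one_div_cancel hm.ne', mul_one, one_div,
        ENNReal.ofReal_inv_of_pos hm, div_eq_mul_inv, inv_inv, mul_comm]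
    rw [e _ _ (by linarith), e _ _ h0] at this
    have key := ENNReal.rpow_le_rpow this (show 0 ≤ 1 / r by positivity)
    refine le_trans (le_of_eq ?_) key
    rw [ENNReal.mul_rpow_of_nonneg _ _ (by positivity), ← ENNReal.rpow_mul, ← ENNReal.rpow_mul]
    congr 2 <;> field_simp

/-- The exponent `(S + γ⁻¹)⁻¹ = γ / (1 + S γ)`, for `S ∈ [0,∞]` and `γ ≥ -S⁻¹`. -/
noncomputable def shiftExponent (S : ℝ≥0∞) (γ : EReal) : EReal :=
  if γ = ⊤ then ((S⁻¹ : ℝ≥0∞) : EReal)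
  else if γ = ⊥ then ⊥
  else if S = ⊤ then 0
  else if 1 + S.toReal * γ.toReal = 0 then ⊥
  else ((γ.toReal / (1 + S.toReal * γ.toReal) : ℝ) : EReal)

theorem shiftExponent_top_right (S : ℝ≥0∞) : shiftExponent S ⊤ = ((S⁻¹ : ℝ≥0∞) : EReal) := by
  simp [shiftExponent]

theorem shiftExponent_bot (S : ℝ≥0∞) : shiftExponent S ⊥ = ⊥ := by
  simp [shiftExponent]

theorem shiftExponent_top_left {γ : EReal} (hγ : γ ≠ ⊥) : shiftExponent ⊤ γ = 0 := by
  simp [shiftExponent, hγ]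

theorem shiftExponent_coe_of_eq {s : ℝ≥0} {r : ℝ} (h : 1 + s * r = 0) :
    shiftExponent s r = ⊥ := by
  simp [shiftExponent, h]

theorem shiftExponent_coe_of_ne {s : ℝ≥0} {r : ℝ} (h : 1 + s * r ≠ 0) :
    shiftExponent s r = ((r / (1 + s * r) : ℝ) : EReal) := by
  simp [shiftExponent, h]

theorem shiftExponent_zero_right (S : ℝ≥0∞) : shiftExponent S 0 = 0 := by
  simp [shiftExponent]

theorem coe_inv_coe_nnreal {s : ℝ≥0} (hs : s ≠ 0) :
    (((s : ℝ≥0∞)⁻¹ : ℝ≥0∞) : EReal) = ((1 / s : ℝ) : EReal) := by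
  rw [← ENNReal.coe_inv hs, EReal.coe_nnreal_eq_coe_real]
  simp

/-- Admissibility of `γ` is nonnegativity of the denominator of `γ / (1 + s γ)`; the boundary case
gives the exponent `-∞`. -/
theorem neg_inv_le_coe_iff (s : ℝ≥0) (r : ℝ) :
    -(((s : ℝ≥0∞)⁻¹ : ℝ≥0∞) : EReal) ≤ (r : EReal) ↔ 0 ≤ 1 + s * r := by
  rcases eq_or_ne s 0 with rfl | hs
  · simp
  · have hs' : 0 < (s : ℝ) := by positivity
    rw [coe_inv_coe_nnreal hs, ← EReal.coe_neg, EReal.coe_le_coe_iff, neg_le,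
      le_div_iff₀ hs']
    constructor <;> intro h <;> linarith

/-- Hölder's inequality for power means, for positive `γ`. -/
theorem powerMean_mul_le_of_pos {s : ℝ≥0} (hs : s ≠ 0) {γ : EReal} (hγ : 0 < γ) {l : ℝ}
    (a b c d : ℝ≥0∞) : powerMean (shiftExponent s γ) l (a * c) (b * d) ≤
      powerMean γ l a b * powerMean ((1 / s : ℝ) : EReal) l c d := by
  have hs' : 0 < (s : ℝ) := by positivity
  have hσ : 0 < 1 / (s : ℝ) := by positivity
  induction γ with
  | bot => simp at hγ
  | top =>
    rw [shiftExponent_top_right, coe_inv_coe_nnreal hs, powerMean_coe hσ.ne', powerMean_coe hσ.ne',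
      powerMean_top]
    set m := max a b
    calc _ ≤ (ENNReal.ofReal (1 - l) * (m * c) ^ (1 / (s : ℝ)) +
            ENNReal.ofReal l * (m * d) ^ (1 / (s : ℝ))) ^ (1 / (1 / (s : ℝ))) := by
          gcongr
          · exact le_max_left _ _
          · exact le_max_right _ _
      _ = _ := by
          rw [ENNReal.mul_rpow_of_nonneg _ _ hσ.le, ENNReal.mul_rpow_of_nonneg _ _ hσ.le,
            mul_left_comm, mul_left_comm (ENNReal.ofReal l), ← mul_add,
            ENNReal.mul_rpow_of_nonneg _ _ (by positivity), ← ENNReal.rpow_mul,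
            mul_one_div_cancel hσ.ne', ENNReal.rpow_one]
  | coe t =>
    have ht : 0 < t := by exact_mod_cast hγ
    have h1 : 0 < 1 + s * t := by positivity
    rw [shiftExponent_coe_of_ne h1.ne', powerMean_coe (by positivity), powerMean_coe ht.ne',
      powerMean_coe hσ.ne']
    refine weighted_holder (by positivity) ht hσ ?_ _ _ _ _ _ _
    field_simp

/-- The map `γ ↦ -φ_s γ` is an involution exchanging admissible negative exponents with exponents in
`(0,∞]`, where `-1/s` corresponds to `∞`. Combined with `powerMean_neg`, it reduces Hölder for
negative `γ` to the positive case. -/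
theorem exists_neg_shiftExponent {s : ℝ≥0} (hs : s ≠ 0) {γ : EReal}
    (hγ : -(((s : ℝ≥0∞)⁻¹ : ℝ≥0∞) : EReal) ≤ γ) (hγ0 : γ < 0) :
    ∃ t : EReal, 0 < t ∧ shiftExponent s γ = -t ∧ γ = -shiftExponent s t := by
  have hs' : 0 < (s : ℝ) := by positivity
  induction γ with
  | bot =>
    rw [coe_inv_coe_nnreal hs, ← EReal.coe_neg] at hγ
    exact absurd hγ (not_le.2 (EReal.bot_lt_coe _))
  | top => simp at hγ0
  | coe r =>
    rw [neg_inv_le_coe_iff] at hγ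
    have hr : r < 0 := by exact_mod_cast hγ0
    rcases hγ.eq_or_lt with h | h
    · refine ⟨⊤, by simp, by rw [shiftExponent_coe_of_eq h.symm, EReal.neg_top], ?_⟩
      rw [shiftExponent_top_right, coe_inv_coe_nnreal hs, ← EReal.coe_neg, EReal.coe_eq_coe_iff]
      field_simp
      linarith
    · have h2 : 0 < -r / (1 + s * r) := div_pos (by linarith) h
      refine ⟨((-r / (1 + s * r) : ℝ) : EReal), by exact_mod_cast h2, ?_, ?_⟩
      · rw [shiftExponent_coe_of_ne h.ne', ← EReal.coe_neg, EReal.coe_eq_coe_iff]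
        ring
      · have h3 : 0 < 1 + s * (-r / (1 + s * r)) := by positivity
        rw [shiftExponent_coe_of_ne h3.ne', ← EReal.coe_neg, EReal.coe_eq_coe_iff]
        have h4 : 1 + s * (-r / (1 + s * r)) = 1 / (1 + s * r) := by field_simp; ring
        rw [h4, div_div_eq_mul_div, div_mul_cancel₀ _ h.ne']
        simp

/-- Hölder's inequality for power means of finite numbers. -/
theorem powerMean_mul_le_of_finite {s : ℝ≥0} (hs : s ≠ 0) {γ : EReal}
    (hγ : -(((s : ℝ≥0∞)⁻¹ : ℝ≥0∞) : EReal) ≤ γ) (hγ0 : γ < 0) {l : ℝ} (hl : l ∈ Set.Ioo (0 : ℝ) 1)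
    (a b c d : ℝ≥0) : powerMean (shiftExponent s γ) l ((a : ℝ≥0∞) * c) ((b : ℝ≥0∞) * d) ≤
      powerMean γ l a b * powerMean ((1 / s : ℝ) : EReal) l c d := by
  have hl' : l ∈ Set.Icc (0 : ℝ) 1 := ⟨hl.1.le, hl.2.le⟩
  obtain ⟨t, ht, h1, h2⟩ := exists_neg_shiftExponent hs hγ hγ0
  have h1' : shiftExponent s γ ≤ 0 := by
    rw [h1, EReal.neg_le, neg_zero]; exact ht.le
  by_cases h0 : a * c = 0
  · rw [← ENNReal.coe_mul, h0, ENNReal.coe_zero, powerMean_zero_left h1' hl]; exact zero_le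
  by_cases h0' : b * d = 0
  · rw [← ENNReal.coe_mul b, h0', ENNReal.coe_zero, powerMean_zero_right h1' hl]; exact zero_le
  have hc : (c : ℝ≥0∞) ≠ 0 := by
    simp only [ne_eq, ENNReal.coe_eq_zero]; rintro rfl; simp at h0
  have hd : (d : ℝ≥0∞) ≠ 0 := by
    simp only [ne_eq, ENNReal.coe_eq_zero]; rintro rfl; simp at h0'
  -- After cancelling `c` and `d`, Hölder for the dual exponent reads `X⁻¹ ≤ Y⁻¹ Z`, with `Y` the
  -- left side and `X`, `Z` the right-hand factors of the claim. Finiteness and nonvanishing then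
  -- allow it to be rearranged to `Y ≤ X Z`.
  have key := powerMean_mul_le_of_pos hs ht (l := l) ((a : ℝ≥0∞) * c)⁻¹ ((b : ℝ≥0∞) * d)⁻¹ c d
  rw [ENNReal.mul_inv (Or.inr ENNReal.coe_ne_top) (Or.inr hc), mul_assoc,
    ENNReal.inv_mul_cancel hc ENNReal.coe_ne_top, mul_one,
    ENNReal.mul_inv (Or.inr ENNReal.coe_ne_top) (Or.inr hd), mul_assoc,
    ENNReal.inv_mul_cancel hd ENNReal.coe_ne_top, mul_one,
    ← ENNReal.mul_inv (Or.inr ENNReal.coe_ne_top) (Or.inr hc),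
    ← ENNReal.mul_inv (Or.inr ENNReal.coe_ne_top) (Or.inr hd)] at key
  have hst : shiftExponent s t ≠ 0 := by
    intro h; rw [h, neg_zero] at h2; exact hγ0.ne h2
  have e1 : powerMean γ l a b = (powerMean (shiftExponent s t) l (a : ℝ≥0∞)⁻¹ (b : ℝ≥0∞)⁻¹)⁻¹ := by
    conv_lhs => rw [h2]
    exact powerMean_neg hst l _ _
  have e2 : powerMean (shiftExponent s γ) l ((a : ℝ≥0∞) * c) ((b : ℝ≥0∞) * d) =
      (powerMean t l ((a : ℝ≥0∞) * c)⁻¹ ((b : ℝ≥0∞) * d)⁻¹)⁻¹ := by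
    rw [h1]; exact powerMean_neg ht.ne' l _ _
  have hY : powerMean (shiftExponent s γ) l ((a : ℝ≥0∞) * c) ((b : ℝ≥0∞) * d) ≠ ⊤ := by
    rw [← ENNReal.coe_mul, ← ENNReal.coe_mul]; exact powerMean_ne_top _ hl' _ _
  have hX := powerMean_ne_top γ hl' a b
  have hZ := powerMean_ne_top ((1 / s : ℝ) : EReal) hl' c d
  rw [← inv_inv (powerMean (shiftExponent s t) l _ _), ← e1, ← inv_inv (powerMean t l _ _),
    ← e2] at key
  set X := powerMean γ l a b
  set Y := powerMean (shiftExponent s γ) l ((a : ℝ≥0∞) * c) ((b : ℝ≥0∞) * d)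
  set Z := powerMean ((1 / s : ℝ) : EReal) l c d
  by_cases hY0 : Y = 0
  · rw [hY0]; exact zero_le
  have hX0 : X ≠ 0 := by
    intro h
    rw [h, ENNReal.inv_zero, top_le_iff] at key
    exact ENNReal.mul_ne_top (ENNReal.inv_ne_top.2 hY0) hZ key
  calc Y = X * (X⁻¹ * Y) := by rw [← mul_assoc, ENNReal.mul_inv_cancel hX0 hX, one_mul]
    _ ≤ X * (Y⁻¹ * Z * Y) := by gcongr
    _ = X * Z := by
      rw [mul_right_comm, ENNReal.inv_mul_cancel hY0 hY, one_mul]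

theorem ENNReal.iSup_min_natCast (a : ℝ≥0∞) : ⨆ n : ℕ, min a n = a := by
  have : ⨆ n : ℕ, min a (n : ℝ≥0∞) = min a (⨆ n : ℕ, (n : ℝ≥0∞)) := inf_iSup_eq _ _ |>.symm
  rw [this, ENNReal.iSup_natCast, min_top_right]

theorem ENNReal.monotone_min_natCast (a : ℝ≥0∞) : Monotone fun n : ℕ => min a (n : ℝ≥0∞) :=
  fun _ _ h => min_le_min_left a (by exact_mod_cast h)

/-- Hölder's inequality for power means. -/
theorem powerMean_mul_le {s : ℝ≥0} (hs : s ≠ 0) {γ : EReal}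
    (hγ : -(((s : ℝ≥0∞)⁻¹ : ℝ≥0∞) : EReal) ≤ γ) {l : ℝ} (hl : l ∈ Set.Ioo (0 : ℝ) 1)
    (a b c d : ℝ≥0∞) : powerMean (shiftExponent s γ) l (a * c) (b * d) ≤
      powerMean γ l a b * powerMean ((1 / s : ℝ) : EReal) l c d := by
  have hl' : l ∈ Set.Icc (0 : ℝ) 1 := ⟨hl.1.le, hl.2.le⟩
  have hσ : 0 < 1 / (s : ℝ) := by positivity
  rcases lt_trichotomy γ 0 with h | rfl | h
  -- Infinite values are reached by increasing truncations, with which the mean commutes.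
  · have e : ∀ x y : ℝ≥0∞, x * y = ⨆ n : ℕ, min x n * min y n := fun x y => by
      conv_lhs => rw [← ENNReal.iSup_min_natCast x, ← ENNReal.iSup_min_natCast y]
      simp only [ENNReal.iSup_mul, ENNReal.mul_iSup]
      refine le_antisymm (iSup₂_le fun i j => ?_) (iSup_le fun i => ?_)
      · exact le_iSup_of_le (max i j) (mul_le_mul'
          (ENNReal.monotone_min_natCast x (le_max_right i j))
          (ENNReal.monotone_min_natCast y (le_max_left i j)))
      · exact le_iSup₂_of_le i i le_rfl
    have hm : ∀ x y : ℝ≥0∞, Monotone fun n : ℕ => min x (n : ℝ≥0∞) * min y n := fun x y i j h =>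
      mul_le_mul' (ENNReal.monotone_min_natCast x h) (ENNReal.monotone_min_natCast y h)
    rw [e a c, e b d, powerMean_iSup _ hl (hm a c) (hm b d)]
    refine iSup_le fun n => ?_
    have fin : ∀ x : ℝ≥0∞, ((min x n).toNNReal : ℝ≥0∞) = min x n := fun x =>
      ENNReal.coe_toNNReal (ne_top_of_le_ne_top (ENNReal.natCast_ne_top n) (min_le_right _ _))
    rw [← fin a, ← fin b, ← fin c, ← fin d]
    refine (powerMean_mul_le_of_finite hs hγ h hl _ _ _ _).trans ?_
    rw [fin a, fin b, fin c, fin d]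
    gcongr
    · exact powerMean_mono _ hl' (min_le_left _ _) (min_le_left _ _)
    · exact powerMean_mono _ hl' (min_le_left _ _) (min_le_left _ _)
  · rw [shiftExponent_zero_right, powerMean_zero, powerMean_zero, ENNReal.mul_rpow_of_nonneg _ _ (by linarith [hl.2]),
      ENNReal.mul_rpow_of_nonneg _ _ hl.1.le, mul_mul_mul_comm]
    gcongr
    rw [← powerMean_zero]
    exact powerMean_zero_le (by exact_mod_cast hσ.le) hl' c d
  · exact powerMean_mul_le_of_pos hs h a b c d

/-! ### Composition of exponent shifts -/

theorem shiftExponent_zero_left (γ : EReal) : shiftExponent 0 γ = γ := by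
  induction γ with
  | bot => exact shiftExponent_bot _
  | top => simp [shiftExponent_top_right]
  | coe r => simpa using shiftExponent_coe_of_ne (s := 0) (r := r) (by simp)

theorem neg_inv_le_of_add {S T : ℝ≥0∞} {γ : EReal}
    (h : -(((S + T)⁻¹ : ℝ≥0∞) : EReal) ≤ γ) : -((T⁻¹ : ℝ≥0∞) : EReal) ≤ γ := by
  refine le_trans (EReal.neg_le_neg_iff.2 ?_) h
  exact EReal.coe_ennreal_le_coe_ennreal_iff.2 (ENNReal.inv_le_inv.2 le_add_self)

/-- Each shift translates `1/γ`, so shifts compose additively. The first conclusion makes the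
intermediate exponent admissible for the second shift. -/
theorem shiftExponent_add {S T : ℝ≥0∞} {γ : EReal}
    (h : -(((S + T)⁻¹ : ℝ≥0∞) : EReal) ≤ γ) :
    -((S⁻¹ : ℝ≥0∞) : EReal) ≤ shiftExponent T γ ∧
      shiftExponent S (shiftExponent T γ) = shiftExponent (S + T) γ := by
  induction γ with
  | bot =>
    simp only [le_bot_iff, EReal.neg_eq_bot_iff, EReal.coe_ennreal_eq_top_iff, ENNReal.inv_eq_top,
      add_eq_zero] at h
    simp [h.1, h.2, shiftExponent_bot]
  | top =>
    rw [shiftExponent_top_right, shiftExponent_top_right]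
    constructor
    · exact le_trans (EReal.neg_le.1 (by simpa using EReal.coe_ennreal_nonneg _))
        (EReal.coe_ennreal_nonneg _)
    · induction T with
      | top =>
        simp only [ENNReal.inv_top, EReal.coe_ennreal_zero, add_top]
        exact shiftExponent_zero_right S
      | coe t =>
        rcases eq_or_ne t 0 with rfl | ht
        · simp [shiftExponent_top_right]
        have ht' : 0 < (t : ℝ) := by positivity
        rw [coe_inv_coe_nnreal ht]
        induction S with
        | top => simpa using shiftExponent_top_left (by simp)
        | coe s =>
          have hs' : 0 ≤ (s : ℝ) := s.2
          have h1 : 0 < 1 + s * (1 / t : ℝ) := by positivity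
          rw [shiftExponent_coe_of_ne h1.ne', ← ENNReal.coe_add, coe_inv_coe_nnreal (by
            intro h; apply ht; exact (add_eq_zero.1 h).2), EReal.coe_eq_coe_iff]
          push_cast
          field_simp
          ring
  | coe r =>
    induction T with
    | top =>
      rw [shiftExponent_top_left (EReal.coe_ne_bot r), add_top,
        shiftExponent_top_left (EReal.coe_ne_bot r)]
      exact ⟨EReal.neg_le.1 (by simpa using EReal.coe_ennreal_nonneg _),
        shiftExponent_zero_right S⟩
    | coe t =>
      induction S with
      | top =>
        have hr : 0 ≤ r := by simpa using h
        have h1 : 0 < 1 + t * r := by positivity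
        rw [top_add, shiftExponent_top_left (EReal.coe_ne_bot r), shiftExponent_coe_of_ne h1.ne']
        refine ⟨?_, shiftExponent_top_left (EReal.coe_ne_bot _)⟩
        simp only [ENNReal.inv_top, EReal.coe_ennreal_zero, neg_zero]
        have : 0 ≤ r / (1 + t * r) := by positivity
        exact_mod_cast this
      | coe s =>
        rw [← ENNReal.coe_add, neg_inv_le_coe_iff] at h
        rw [← ENNReal.coe_add]
        have hadd : ((s + t : ℝ≥0) : ℝ) = s + t := rfl
        rw [hadd] at h
        have hs' : 0 ≤ (s : ℝ) := s.2
        have ht' : 0 ≤ (t : ℝ) := t.2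
        rcases eq_or_ne s 0 with rfl | hs
        · rw [zero_add, ENNReal.coe_zero, shiftExponent_zero_left]
          simp
        have hs0 : 0 < (s : ℝ) := by positivity
        -- For `r < 0` this exceeds `1 + (s + t) r ≥ 0` by `-s r > 0`; the case `s = 0`, where it
        -- could vanish, is already settled.
        have h1 : 0 < 1 + t * r := by
          rcases le_or_gt 0 r with hr | hr
          · positivity
          · nlinarith
        have e : 1 + s * (r / (1 + t * r)) = (1 + (s + t) * r) / (1 + t * r) := by
          rw [eq_div_iff h1.ne', add_mul, mul_assoc (s : ℝ), div_mul_cancel₀ _ h1.ne']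
          ring
        rw [shiftExponent_coe_of_ne h1.ne', neg_inv_le_coe_iff, e]
        refine ⟨by positivity, ?_⟩
        by_cases h0 : 1 + ((s : ℝ) + t) * r = 0
        · rw [shiftExponent_coe_of_eq (by rw [e, h0, zero_div]),
            shiftExponent_coe_of_eq (by rw [hadd, h0])]
        · rw [shiftExponent_coe_of_ne (by rw [e]; exact div_ne_zero h0 h1.ne'),
            shiftExponent_coe_of_ne (by rwa [hadd]), e, hadd, EReal.coe_eq_coe_iff,
            div_div_div_cancel_right₀ h1.ne']

theorem combinedExponent_eq {S : ℝ≥0∞} (hS : S ≠ 0) {γ : EReal}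
    (h : -((S⁻¹ : ℝ≥0∞) : EReal) ≤ γ) : combinedExponent S γ = shiftExponent S γ := by
  have hγ : γ ≠ ⊥ := by
    rintro rfl
    simp [hS] at h
  induction S with
  | top => simp [combinedExponent, shiftExponent_top_left hγ]
  | coe s =>
    have hs : s ≠ 0 := by simpa using hS
    have hs' : 0 < (s : ℝ) := by positivity
    unfold combinedExponent
    rw [coe_inv_coe_nnreal hs]
    induction γ with
    | bot => exact absurd rfl hγ
    | top =>
      rw [if_neg (by simp), if_neg (by rw [← EReal.coe_neg]; exact (EReal.coe_ne_top _).symm),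
        shiftExponent_top_right, coe_inv_coe_nnreal hs, EReal.inv_top, add_zero,
        EReal.coe_nnreal_eq_coe_real, ← EReal.coe_inv]
      simp
    | coe r =>
      rw [neg_inv_le_coe_iff] at h
      rcases eq_or_ne r 0 with rfl | hr
      · simp [shiftExponent_zero_right]
      rw [if_neg (by simpa using hr)]
      have e : ((r : ℝ) : EReal) = -((1 / s : ℝ) : EReal) ↔ 1 + s * r = 0 := by
        rw [← EReal.coe_neg, EReal.coe_eq_coe_iff]
        constructor
        · rintro rfl; field_simp; ring
        · intro h; field_simp; linarith
      by_cases h0 : 1 + s * r = 0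
      · rw [if_pos (e.2 h0), shiftExponent_coe_of_eq h0]
      · rw [if_neg (fun h => h0 (e.1 h)), shiftExponent_coe_of_ne h0, EReal.coe_nnreal_eq_coe_real,
          ← EReal.coe_inv, ← EReal.coe_add, ← EReal.coe_inv, EReal.coe_eq_coe_iff]
        have : (s : ℝ) + r⁻¹ = (1 + s * r) / r := by field_simp; ring
        rw [this, inv_div]

/-! ### The Brunn–Minkowski inequality on the line -/

open scoped Pointwise in
theorem Real.volume_image_mul_add {m : ℝ} (hm : 0 ≤ m) (d : ℝ) (K : Set ℝ) :
    volume ((fun x => m * x + d) '' K) = ENNReal.ofReal m * volume K := by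
  have : (fun x => m * x + d) '' K = (fun x => x + d) '' ((fun x => m • x) '' K) := by
    rw [Set.image_image]
    rfl
  rw [this, Set.image_add_right, measure_preimage_add_right, Set.image_smul,
    Measure.addHaar_smul]
  simp [abs_of_nonneg hm]

/-- The Brunn–Minkowski inequality for compact sets in dimension one. -/
theorem brunn_minkowski_real_of_isCompact {l : ℝ} (hl : l ∈ Set.Icc (0 : ℝ) 1) {K L Z : Set ℝ}
    (hK : IsCompact K) (hL : IsCompact L) (hK0 : K.Nonempty) (hL0 : L.Nonempty)
    (h : ∀ x ∈ K, ∀ y ∈ L, (1 - l) * x + l * y ∈ Z) :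
    ENNReal.ofReal (1 - l) * volume K + ENNReal.ofReal l * volume L ≤ volume Z := by
  have h1 : 0 ≤ 1 - l := by linarith [hl.2]
  set a := sSup K
  set b := sInf L
  have ha : a ∈ K := hK.sSup_mem hK0
  have hb : b ∈ L := hL.sInf_mem hL0
  -- With `a = max K` and `b = min L`, the translates `(1-l)K + lb` and `(1-l)a + lL` both lie in
  -- `Z` and meet at most in `(1-l)a + lb`.
  set U := (fun x => (1 - l) * x + l * b) '' K with hU
  set V := (fun y => l * y + (1 - l) * a) '' L with hV
  have hVc : IsCompact V := hL.image (by fun_prop)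
  have hUV : AEDisjoint volume U V := by
    refine measure_mono_null (t := {(1 - l) * a + l * b}) ?_ (by simp)
    rintro _ ⟨⟨x, hx, rfl⟩, ⟨y, hy, hxy⟩⟩
    have hx' : x ≤ a := le_csSup hK.bddAbove hx
    have hy' : b ≤ y := csInf_le hL.bddBelow hy
    simp only [Set.mem_singleton_iff] at hxy ⊢
    have e1 := mul_le_mul_of_nonneg_left hx' h1
    have e2 := mul_le_mul_of_nonneg_left hy' hl.1
    linarith
  rw [← Real.volume_image_mul_add h1 (l * b), ← Real.volume_image_mul_add hl.1 ((1 - l) * a),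
    ← measure_union₀ hVc.measurableSet.nullMeasurableSet hUV]
  refine measure_mono (Set.union_subset ?_ ?_)
  · rintro _ ⟨x, hx, rfl⟩
    exact h x hx b hb
  · rintro _ ⟨y, hy, rfl⟩
    have := h a ha y hy
    rwa [add_comm] at this

/-- The Brunn–Minkowski inequality in dimension one. -/
theorem brunn_minkowski_real {l : ℝ} (hl : l ∈ Set.Icc (0 : ℝ) 1) {X Y X' Y' Z : Set ℝ}
    (hX : MeasurableSet X) (hY : MeasurableSet Y) (hXX : X ⊆ X') (hYY : Y ⊆ Y')
    (hX0 : X'.Nonempty) (hY0 : Y'.Nonempty)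
    (h : ∀ x ∈ X', ∀ y ∈ Y', (1 - l) * x + l * y ∈ Z) :
    ENNReal.ofReal (1 - l) * volume X + ENNReal.ofReal l * volume Y ≤ volume Z := by
  have e : ∀ {W : Set ℝ}, MeasurableSet W →
      volume W = ⨆ K : {K : Set ℝ // K ⊆ W ∧ IsCompact K}, volume (K : Set ℝ) := fun {W} hW => by
    refine le_antisymm ?_ (iSup_le fun K => measure_mono K.2.1)
    rw [hW.measure_eq_iSup_isCompact]
    exact iSup_le fun K => iSup₂_le fun h1 h2 =>
      le_iSup (fun K : {K : Set ℝ // K ⊆ W ∧ IsCompact K} => volume (K : Set ℝ)) ⟨K, h1, h2⟩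
  have ne : ∀ W : Set ℝ, Nonempty {K : Set ℝ // K ⊆ W ∧ IsCompact K} := fun W =>
    ⟨⟨∅, Set.empty_subset _, isCompact_empty⟩⟩
  have := ne X
  have := ne Y
  rw [e hX, e hY, ENNReal.mul_iSup, ENNReal.mul_iSup]
  refine ENNReal.iSup_add_iSup_le fun K L => ?_
  obtain ⟨x0, hx0⟩ := hX0
  obtain ⟨y0, hy0⟩ := hY0
  -- `X` or `Y` may be empty; adding a point of `X'` or `Y'` makes the compact sets nonempty.
  refine le_trans ?_ (brunn_minkowski_real_of_isCompact (K := insert x0 K) (L := insert y0 L) hl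
    (K.2.2.insert x0) (L.2.2.insert y0) ⟨x0, by simp⟩ ⟨y0, by simp⟩
    (fun x hx y hy => h x ?_ y ?_))
  · gcongr <;> exact Set.subset_insert _ _
  · rcases hx with rfl | hx
    · exact hx0
    · exact hXX (K.2.1 hx)
  · rcases hy with rfl | hy
    · exact hy0
    · exact hYY (L.2.1 hy)

/-! ### The Borell–Brascamp–Lieb inequality on the line -/

/-- Layer cake formula for `min f 1`. -/
theorem lintegral_min_one_eq_lintegral_meas_le {α : Type*} [MeasurableSpace α] (μ : Measure α)
    [SFinite μ] {f : α → ℝ≥0∞} (hf : Measurable f) :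
    ∫⁻ x, min (f x) 1 ∂μ = ∫⁻ t in Set.Ioo (0 : ℝ) 1, μ {x | ENNReal.ofReal t ≤ f x} := by
  have hm : MeasurableSet {q : α × ℝ | ENNReal.ofReal q.2 ≤ f q.1} :=
    measurableSet_le (by fun_prop) (by fun_prop)
  have e1 : ∀ a : ℝ≥0∞,
      (volume.restrict (Set.Ioo (0 : ℝ) 1)) {t | ENNReal.ofReal t ≤ a} = min a 1 := fun a => by
    have hs : MeasurableSet {t : ℝ | ENNReal.ofReal t ≤ a} :=
      measurableSet_le (by fun_prop) measurable_const
    rw [Measure.restrict_apply hs]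
    rcases le_or_gt 1 a with h | h
    · rw [min_eq_right h]
      have : {t : ℝ | ENNReal.ofReal t ≤ a} ∩ Set.Ioo 0 1 = Set.Ioo 0 1 := by
        refine Set.inter_eq_right.2 fun t ht => le_trans ?_ h
        simpa using ht.2.le
      simp [this]
    · rw [min_eq_left h.le]
      have ha : a ≠ ⊤ := (h.trans ENNReal.one_lt_top).ne
      have : {t : ℝ | ENNReal.ofReal t ≤ a} ∩ Set.Ioo 0 1 = Set.Ioc 0 a.toReal := by
        ext t
        simp only [Set.mem_inter_iff, Set.mem_ofPred_eq, Set.mem_Ioo, Set.mem_Ioc,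
          ENNReal.ofReal_le_iff_le_toReal ha]
        have : a.toReal < 1 := by
          rw [← ENNReal.toReal_one]; exact (ENNReal.toReal_lt_toReal ha ENNReal.one_ne_top).2 h
        constructor
        · rintro ⟨h1, h2, h3⟩; exact ⟨h2, h1⟩
        · rintro ⟨h1, h2⟩; exact ⟨h2, h1, by linarith⟩
      rw [this, Real.volume_Ioc, sub_zero, ENNReal.ofReal_toReal ha]
  have e2 := Measure.prod_apply (μ := μ) (ν := volume.restrict (Set.Ioo (0 : ℝ) 1)) hm
  have e3 := Measure.prod_apply_symm (μ := μ) (ν := volume.restrict (Set.Ioo (0 : ℝ) 1)) hm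
  rw [e2] at e3
  simpa only [Set.preimage_ofPred_eq, e1] using e3

theorem powerMean_one (l : ℝ) (a b : ℝ≥0∞) :
    powerMean ((1 : ℝ) : EReal) l a b = ENNReal.ofReal (1 - l) * a + ENNReal.ofReal l * b := by
  rw [powerMean_coe one_ne_zero]
  simp

/-- The Borell–Brascamp–Lieb inequality on `ℝ` for bounded functions. -/
theorem borell_brascamp_lieb_real_of_bounded {δ : EReal} (hδ : -(1 : EReal) ≤ δ) {l : ℝ}
    (hl : l ∈ Set.Ioo (0 : ℝ) 1) {f g h : ℝ → ℝ≥0∞} (hf : Measurable f) (hg : Measurable g)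
    (hh : Measurable h) {A B : Set ℝ} (hA : A.Nonempty) (hB : B.Nonempty)
    (hfA : ∀ x, f x ≠ 0 → x ∈ A) (hgB : ∀ y, g y ≠ 0 → y ∈ B)
    (hf' : (⨆ x, f x) ≠ ⊤) (hg' : (⨆ x, g x) ≠ ⊤)
    (hfgh : ∀ x ∈ A, ∀ y ∈ B, powerMean δ l (f x) (g y) ≤ h ((1 - l) * x + l * y)) :
    powerMean (shiftExponent 1 δ) l (∫⁻ x, f x) (∫⁻ x, g x) ≤ ∫⁻ x, h x := by
  have hl' : l ∈ Set.Icc (0 : ℝ) 1 := ⟨hl.1.le, hl.2.le⟩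
  set a := ⨆ x, f x with ha
  set b := ⨆ x, g x with hb
  have norm : ∀ {u : ℝ → ℝ≥0∞}, (⨆ x, u x) ≠ ⊤ → ∀ x, u x = (⨆ x, u x) * (u x / ⨆ x, u x) := by
    intro u hu x
    rcases eq_or_ne (⨆ x, u x) 0 with h0 | h0
    · have : u x = 0 := by simpa using (ENNReal.iSup_eq_zero.1 h0) x
      simp [this]
    · rw [ENNReal.mul_div_cancel h0 hu]
  -- If `sup u = 0`, the normalised level set is empty, since `0 / 0 = 0`, while the larger set is
  -- all of `D`; hence the two sets in `brunn_minkowski_real`.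
  have level : ∀ {u : ℝ → ℝ≥0∞} {D : Set ℝ}, (⨆ x, u x) ≠ ⊤ → D.Nonempty →
      (∀ x, u x ≠ 0 → x ∈ D) → ∀ t ∈ Set.Ioo (0 : ℝ) 1,
      {x | x ∈ D ∧ ENNReal.ofReal t * (⨆ x, u x) ≤ u x}.Nonempty ∧
      {x | ENNReal.ofReal t ≤ u x / ⨆ x, u x} ⊆
        {x | x ∈ D ∧ ENNReal.ofReal t * (⨆ x, u x) ≤ u x} := by
    intro u D hu hD huD t ht
    constructor
    · rcases eq_or_ne (⨆ x, u x) 0 with h0 | h0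
      · obtain ⟨x, hx⟩ := hD
        exact ⟨x, hx, by simp [h0]⟩
      · have : ENNReal.ofReal t * (⨆ x, u x) < ⨆ x, u x := by
          conv_rhs => rw [← one_mul (⨆ x, u x)]
          exact ENNReal.mul_lt_mul_left h0 hu (by simpa using ht.2)
        obtain ⟨x, hx⟩ := lt_iSup_iff.1 this
        exact ⟨x, huD x (ne_bot_of_gt hx), hx.le⟩
    · intro x hx
      have hx' : ENNReal.ofReal t ≤ u x / ⨆ x, u x := hx
      refine ⟨huD x ?_, ?_⟩
      · intro h0
        rw [h0, ENNReal.zero_div, nonpos_iff_eq_zero, ENNReal.ofReal_eq_zero] at hx'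
        linarith [ht.1]
      · conv_rhs => rw [norm hu x, mul_comm]
        gcongr
  have nle : ∀ {u : ℝ → ℝ≥0∞} (x : ℝ), u x / (⨆ x, u x) ≤ 1 := fun {u} x =>
    ENNReal.div_le_of_le_mul (by rw [one_mul]; exact le_iSup u x)
  have e1 : ∫⁻ x, f x = a * ∫⁻ x, f x / a := by
    rw [← lintegral_const_mul _ (hf.div_const _)]
    exact lintegral_congr (norm hf')
  have e2 : ∫⁻ x, g x = b * ∫⁻ x, g x / b := by
    rw [← lintegral_const_mul _ (hg.div_const _)]
    exact lintegral_congr (norm hg')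
  have hold := powerMean_mul_le (s := 1) one_ne_zero (γ := δ) (by simpa using hδ) hl
    a b (∫⁻ x, f x / a) (∫⁻ x, g x / b)
  rw [← e1, ← e2, NNReal.coe_one, one_div_one, powerMean_one, ENNReal.coe_one] at hold
  refine hold.trans ?_
  have hC : powerMean δ l a b ≠ ⊤ := by
    rw [← ENNReal.coe_toNNReal hf', ← ENNReal.coe_toNNReal hg']
    exact powerMean_ne_top δ hl' _ _
  set C := powerMean δ l a b with hCdef
  rcases eq_or_ne C 0 with hC0 | hC0
  · rw [hC0, zero_mul]; exact zero_le
  have cake : ∀ {u : ℝ → ℝ≥0∞}, Measurable u → ∫⁻ x, u x / (⨆ x, u x) =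
      ∫⁻ t in Set.Ioo (0 : ℝ) 1, volume {x | ENNReal.ofReal t ≤ u x / ⨆ x, u x} := by
    intro u hu
    rw [← lintegral_min_one_eq_lintegral_meas_le volume (hu.div_const _)]
    exact lintegral_congr fun x => (min_eq_left (nle x)).symm
  have meas : ∀ {u : ℝ → ℝ≥0∞}, Measurable u →
      Measurable fun t : ℝ => volume {x | ENNReal.ofReal t ≤ u x} := by
    intro u hu
    have hm : MeasurableSet {q : ℝ × ℝ | ENNReal.ofReal q.1 ≤ u q.2} :=
      measurableSet_le (by fun_prop) (by fun_prop)
    exact measurable_measure_prodMk_left hm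
  calc C * ((ENNReal.ofReal (1 - l) * ∫⁻ x, f x / a) + ENNReal.ofReal l * ∫⁻ x, g x / b)
      = C * ∫⁻ t in Set.Ioo (0 : ℝ) 1, (ENNReal.ofReal (1 - l) *
          volume {x | ENNReal.ofReal t ≤ f x / a} +
          ENNReal.ofReal l * volume {x | ENNReal.ofReal t ≤ g x / b}) := by
        rw [lintegral_add_left ((meas (hf.div_const _)).const_mul _),
          lintegral_const_mul _ (meas (hf.div_const _)),
          lintegral_const_mul _ (meas (hg.div_const _)), ← cake hf, ← cake hg]
    _ ≤ C * ∫⁻ t in Set.Ioo (0 : ℝ) 1, volume {x | ENNReal.ofReal t ≤ h x / C} := by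
        refine mul_le_mul' le_rfl (setLIntegral_mono' measurableSet_Ioo fun t ht => ?_)
        obtain ⟨n1, s1⟩ := level hf' hA hfA t ht
        obtain ⟨n2, s2⟩ := level hg' hB hgB t ht
        refine brunn_minkowski_real hl' (hf.div_const a measurableSet_Ici)
          (hg.div_const b measurableSet_Ici) s1 s2 n1 n2 ?_
        rintro x ⟨hxA, hx⟩ y ⟨hyB, hy⟩
        refine (ENNReal.le_div_iff_mul_le (Or.inl hC0) (Or.inl hC)).2 ?_
        rw [hCdef, ← powerMean_mul_left δ hl' (by simpa using ht.1) ENNReal.ofReal_ne_top]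
        exact (powerMean_mono δ hl' hx hy).trans (hfgh x hxA y hyB)
    -- Heights `t < 1` only see `min (h/C) 1`, which suffices for a lower bound.
    _ ≤ C * ∫⁻ x, h x / C := by
        rw [← lintegral_min_one_eq_lintegral_meas_le volume (hh.div_const _)]
        gcongr
        exact min_le_left _ _
    _ ≤ ∫⁻ x, h x := by
        rw [← lintegral_const_mul _ (hh.div_const _)]
        exact lintegral_mono fun x => ENNReal.mul_div_le

/-- The Borell–Brascamp–Lieb inequality on `ℝ`. The hypothesis is required on a product `A × B` of
nonempty sets outside of which `f` and `g` vanish. -/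
theorem borell_brascamp_lieb_real {δ : EReal} (hδ : -(1 : EReal) ≤ δ) {l : ℝ}
    (hl : l ∈ Set.Ioo (0 : ℝ) 1) {f g h : ℝ → ℝ≥0∞} (hf : Measurable f) (hg : Measurable g)
    (hh : Measurable h) {A B : Set ℝ} (hA : A.Nonempty) (hB : B.Nonempty)
    (hfA : ∀ x, f x ≠ 0 → x ∈ A) (hgB : ∀ y, g y ≠ 0 → y ∈ B)
    (hfgh : ∀ x ∈ A, ∀ y ∈ B, powerMean δ l (f x) (g y) ≤ h ((1 - l) * x + l * y)) :
    powerMean (shiftExponent 1 δ) l (∫⁻ x, f x) (∫⁻ x, g x) ≤ ∫⁻ x, h x := by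
  have hl' : l ∈ Set.Icc (0 : ℝ) 1 := ⟨hl.1.le, hl.2.le⟩
  have e : ∀ {u : ℝ → ℝ≥0∞}, Measurable u → ∫⁻ x, u x = ⨆ n : ℕ, ∫⁻ x, min (u x) n := by
    intro u hu
    rw [← lintegral_iSup (fun n => hu.min measurable_const)
      (fun i j hij x => ENNReal.monotone_min_natCast (u x) hij)]
    exact lintegral_congr fun x => (ENNReal.iSup_min_natCast (u x)).symm
  have mono : ∀ u : ℝ → ℝ≥0∞, Monotone fun n : ℕ => ∫⁻ x, min (u x) n := fun u i j hij =>
    lintegral_mono fun x => ENNReal.monotone_min_natCast (u x) hij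
  have bdd : ∀ (u : ℝ → ℝ≥0∞) (n : ℕ), (⨆ x, min (u x) n) ≠ ⊤ := fun u n =>
    ne_top_of_le_ne_top (ENNReal.natCast_ne_top n) (iSup_le fun x => min_le_right _ _)
  rw [e hf, e hg, powerMean_iSup _ hl (mono f) (mono g)]
  refine iSup_le fun n => borell_brascamp_lieb_real_of_bounded hδ hl (hf.min measurable_const)
    (hg.min measurable_const) hh hA hB (fun x hx => hfA x fun h0 => hx (by simp [h0]))
    (fun x hx => hgB x fun h0 => hx (by simp [h0])) (bdd f n) (bdd g n) fun x hx y hy => ?_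
  exact (powerMean_mono δ hl' (min_le_left _ _) (min_le_left _ _)).trans (hfgh x hx y hy)

/-! ### The inequality on the half-line -/

/-- Lebesgue measure on `[0,∞)`. -/
noncomputable def halfLineVolume : Measure ℝ≥0 :=
  Measure.comap (fun x : ℝ≥0 => (x : ℝ)) volume

theorem range_coe_nnreal : Set.range (fun x : ℝ≥0 => (x : ℝ)) = Set.Ici 0 :=
  Set.ext fun z => ⟨fun ⟨x, hx⟩ => hx ▸ x.2, fun hz => ⟨⟨z, hz⟩, rfl⟩⟩

theorem measurableEmbedding_coe_nnreal : MeasurableEmbedding (fun x : ℝ≥0 => (x : ℝ)) := by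
  refine Topology.IsClosedEmbedding.measurableEmbedding ⟨NNReal.isEmbedding_coe, ?_⟩
  rw [range_coe_nnreal]
  exact isClosed_Ici

instance : SigmaFinite halfLineVolume := by
  refine SigmaFinite.of_map halfLineVolume
    measurableEmbedding_coe_nnreal.measurable.aemeasurable ?_
  rw [halfLineVolume, measurableEmbedding_coe_nnreal.map_comap]
  infer_instance

theorem lintegral_nnreal_eq (f : ℝ≥0 → ℝ≥0∞) :
    ∫⁻ x, f x ∂halfLineVolume = ∫⁻ x in Set.Ioi (0 : ℝ), f x.toNNReal := by
  rw [setLIntegral_congr (Ioi_ae_eq_Ici (a := (0 : ℝ))), ← range_coe_nnreal,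
    ← measurableEmbedding_coe_nnreal.map_comap, measurableEmbedding_coe_nnreal.lintegral_map]
  simp [halfLineVolume]

/-- The point `0` is null but is kept in the indicator, because the sets `A` and `B` may consist of
`0` alone. -/
theorem lintegral_nnreal_eq_rpow {r : ℝ} (hr : 0 < r) (f : ℝ≥0 → ℝ≥0∞) :
    ∫⁻ x, f x ∂halfLineVolume = ∫⁻ u, (Set.Ici (0 : ℝ)).indicator
      (fun u => f (u ^ r).toNNReal * ENNReal.ofReal (r * u ^ (r - 1))) u := by
  have himg : (fun u : ℝ => u ^ r) '' Set.Ioi 0 = Set.Ioi 0 := by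
    ext x
    simp only [Set.mem_image, Set.mem_Ioi]
    constructor
    · rintro ⟨u, hu, rfl⟩
      positivity
    · intro hx
      exact ⟨x ^ r⁻¹, by positivity, Real.rpow_inv_rpow hx.le hr.ne'⟩
  rw [lintegral_nnreal_eq, lintegral_indicator measurableSet_Ici,
    ← setLIntegral_congr (Ioi_ae_eq_Ici (a := (0 : ℝ)))]
  conv_lhs => rw [← himg]
  rw [lintegral_image_eq_lintegral_abs_deriv_mul measurableSet_Ioi
    (f' := fun u => r * u ^ (r - 1))
    (fun u hu => (Real.hasDerivAt_rpow_const (Or.inl (ne_of_gt hu))).hasDerivWithinAt)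
    (fun u hu v hv huv => (Real.rpow_left_inj (le_of_lt hu) (le_of_lt hv) hr.ne').1 huv)]
  refine setLIntegral_congr_fun measurableSet_Ioi fun u hu => ?_
  have hu' : 0 < u := hu
  rw [mul_comm, abs_of_nonneg (by positivity)]

theorem lintegral_nnreal_eq_exp (f : ℝ≥0 → ℝ≥0∞) :
    ∫⁻ x, f x ∂halfLineVolume = ∫⁻ u, ENNReal.ofReal (Real.exp u) * f (Real.exp u).toNNReal := by
  rw [lintegral_nnreal_eq, ← Real.range_exp, ← Set.image_univ,
    lintegral_image_eq_lintegral_abs_deriv_mul MeasurableSet.univ (f' := Real.exp)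
    (fun u _ => (Real.hasDerivAt_exp u).hasDerivWithinAt) Real.exp_injective.injOn]
  simp [abs_of_pos (Real.exp_pos _)]

/-- Serves twice: `r = 1/q` linearises the mean of the coordinates, and `r = 1/q - 1` handles the
Jacobian. -/
theorem powerMean_ofReal_rpow {l : ℝ} (hl : l ∈ Set.Icc (0 : ℝ) 1) {r : ℝ} (hr : 0 < r) {u v : ℝ}
    (hu : 0 ≤ u) (hv : 0 ≤ v) :
    powerMean ((1 / r : ℝ) : EReal) l (ENNReal.ofReal (u ^ r)) (ENNReal.ofReal (v ^ r)) =
      ENNReal.ofReal (((1 - l) * u + l * v) ^ r) := by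
  have h1 : 0 ≤ 1 - l := by linarith [hl.2]
  have h0 := hl.1
  have hr' : 0 < 1 / r := by positivity
  rw [powerMean_coe hr'.ne', ENNReal.ofReal_rpow_of_nonneg (by positivity) hr'.le,
    ENNReal.ofReal_rpow_of_nonneg (by positivity) hr'.le, ← Real.rpow_mul hu, ← Real.rpow_mul hv,
    mul_one_div_cancel hr.ne', Real.rpow_one, Real.rpow_one, ← ENNReal.ofReal_mul h1,
    ← ENNReal.ofReal_mul h0, ← ENNReal.ofReal_add (by positivity) (by positivity),
    ENNReal.ofReal_rpow_of_nonneg (by positivity) (by positivity), one_div_one_div]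

theorem powerMean_zero_ofReal_exp (l : ℝ) (u v : ℝ) :
    powerMean 0 l (ENNReal.ofReal (Real.exp u)) (ENNReal.ofReal (Real.exp v)) =
      ENNReal.ofReal (Real.exp ((1 - l) * u + l * v)) := by
  rw [powerMean_zero, ENNReal.ofReal_rpow_of_pos (Real.exp_pos u),
    ENNReal.ofReal_rpow_of_pos (Real.exp_pos v), ← ENNReal.ofReal_mul (by positivity),
    ← Real.exp_mul, ← Real.exp_mul, ← Real.exp_add, mul_comm u, mul_comm v]

/-- Hölder absorbs the Jacobian `c u^s` because `M_{1/s}(u^s, v^s)` is exactly `((1-l)u + lv)^s`.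
For `s = 0` the Jacobian is constant and homogeneity suffices. -/
theorem powerMean_mul_rpow_le {s : ℝ≥0} {γ : EReal}
    (hγ : -(((s : ℝ≥0∞)⁻¹ : ℝ≥0∞) : EReal) ≤ γ) {l : ℝ} (hl : l ∈ Set.Ioo (0 : ℝ) 1)
    (a b : ℝ≥0∞) {c : ℝ} (hc : 0 < c) {u v : ℝ} (hu : 0 ≤ u) (hv : 0 ≤ v) :
    powerMean (shiftExponent s γ) l (a * ENNReal.ofReal (c * u ^ (s : ℝ)))
      (b * ENNReal.ofReal (c * v ^ (s : ℝ))) ≤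
      powerMean γ l a b * ENNReal.ofReal (c * ((1 - l) * u + l * v) ^ (s : ℝ)) := by
  have hl' : l ∈ Set.Icc (0 : ℝ) 1 := ⟨hl.1.le, hl.2.le⟩
  rcases eq_or_ne s 0 with rfl | hs
  · rw [ENNReal.coe_zero, shiftExponent_zero_left]
    simp only [NNReal.coe_zero, Real.rpow_zero, mul_one]
    rw [mul_comm a, mul_comm b, powerMean_mul_left γ hl' (by simpa using hc) ENNReal.ofReal_ne_top,
      mul_comm]
  · refine (powerMean_mul_le hs hγ hl _ _ _ _).trans (le_of_eq ?_)
    have hs' : 0 < (s : ℝ) := by positivity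
    rw [ENNReal.ofReal_mul hc.le, ENNReal.ofReal_mul hc.le, ENNReal.ofReal_mul hc.le,
      powerMean_mul_left _ hl' (by simpa using hc) ENNReal.ofReal_ne_top,
      powerMean_ofReal_rpow hl' hs' hu hv]

theorem borell_brascamp_lieb_nnreal_of_ne_zero {q : ℝ≥0} (hq0 : q ≠ 0) (hq : q ≤ 1) {γ : EReal}
    (hγ : -((((q : ℝ≥0∞)⁻¹)⁻¹ : ℝ≥0∞) : EReal) ≤ γ) {l : ℝ} (hl : l ∈ Set.Ioo (0 : ℝ) 1)
    {f g h : ℝ≥0 → ℝ≥0∞} (hf : Measurable f) (hg : Measurable g) (hh : Measurable h)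
    {A B : Set ℝ≥0} (hA : A.Nonempty) (hB : B.Nonempty)
    (hfA : ∀ x, f x ≠ 0 → x ∈ A) (hgB : ∀ y, g y ≠ 0 → y ∈ B)
    (hfgh : ∀ x ∈ A, ∀ y ∈ B, powerMean γ l (f x) (g y) ≤
      h (powerMean ((q : ℝ) : EReal) l x y).toNNReal) :
    powerMean (shiftExponent (q : ℝ≥0∞)⁻¹ γ) l (∫⁻ x, f x ∂halfLineVolume) (∫⁻ x, g x ∂halfLineVolume) ≤
      ∫⁻ x, h x ∂halfLineVolume := by
  have hl' : l ∈ Set.Icc (0 : ℝ) 1 := ⟨hl.1.le, hl.2.le⟩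
  have hq' : 0 < (q : ℝ) := by positivity
  -- The power of `u` in the Jacobian of `x = u^{1/q}`. Since `q ≤ 1`, the truncated subtraction is
  -- exact and `1 + s = 1/q` is the total shift.
  set s : ℝ≥0 := q⁻¹ - 1 with hs
  have h1s : 1 + s = q⁻¹ := add_tsub_cancel_of_le ((one_le_inv₀ (by positivity)).2 hq)
  have h1s' : ((1 : ℝ≥0∞) + s) = (q : ℝ≥0∞)⁻¹ := by
    rw [← ENNReal.coe_inv hq0, ← h1s]; push_cast; rfl
  set r : ℝ := 1 / q with hr
  have hr0 : 0 < r := by positivity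
  have hrs : r - 1 = s := by
    have : ((1 + s : ℝ≥0) : ℝ) = ((q⁻¹ : ℝ≥0) : ℝ) := by rw [h1s]
    push_cast at this
    rw [hr, one_div]
    linarith
  have hrq : (q : ℝ) = 1 / r := by rw [hr, one_div_one_div]
  rw [← h1s'] at hγ
  obtain ⟨hδ, hcomp⟩ := shiftExponent_add hγ
  rw [← h1s', ← hcomp, lintegral_nnreal_eq_rpow hr0 f, lintegral_nnreal_eq_rpow hr0 g,
    lintegral_nnreal_eq_rpow hr0 h]
  have meas : ∀ {u : ℝ≥0 → ℝ≥0∞}, Measurable u → Measurable ((Set.Ici (0 : ℝ)).indicator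
      (fun t => u (t ^ r).toNNReal * ENNReal.ofReal (r * t ^ (r - 1)))) := fun {u} hu => by
    refine Measurable.indicator ?_ measurableSet_Ici
    fun_prop
  have inv : ∀ x : ℝ≥0, (((x : ℝ) ^ (1 / r)) ^ r).toNNReal = x := fun x => by
    rw [← Real.rpow_mul x.coe_nonneg, one_div_mul_cancel hr0.ne', Real.rpow_one, Real.toNNReal_coe]
  have supp : ∀ {u : ℝ≥0 → ℝ≥0∞} {D : Set ℝ≥0}, (∀ x, u x ≠ 0 → x ∈ D) → ∀ x : ℝ,
      (Set.Ici (0 : ℝ)).indicator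
        (fun t => u (t ^ r).toNNReal * ENNReal.ofReal (r * t ^ (r - 1))) x ≠ 0 →
      x ∈ {t : ℝ | 0 ≤ t ∧ (t ^ r).toNNReal ∈ D} := by
    intro u D huD x hx
    rw [Set.indicator_apply_ne_zero] at hx
    exact ⟨hx.1, huD _ (left_ne_zero_of_mul hx.2)⟩
  have nonempty : ∀ {D : Set ℝ≥0}, D.Nonempty → {t : ℝ | 0 ≤ t ∧ (t ^ r).toNNReal ∈ D}.Nonempty :=
    fun {D} ⟨x, hx⟩ => ⟨(x : ℝ) ^ (1 / r), by positivity, by rw [inv]; exact hx⟩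
  refine borell_brascamp_lieb_real (by simpa using hδ) hl (meas hf) (meas hg) (meas hh)
    (nonempty hA) (nonempty hB) (supp hfA) (supp hgB) ?_
  rintro u ⟨hu, huA⟩ v ⟨hv, hvB⟩
  have hz : 0 ≤ (1 - l) * u + l * v := by
    have := hl'.1
    have : 0 ≤ 1 - l := by linarith [hl'.2]
    positivity
  rw [Set.indicator_of_mem (show u ∈ Set.Ici 0 from hu),
    Set.indicator_of_mem (show v ∈ Set.Ici 0 from hv),
    Set.indicator_of_mem (show (1 - l) * u + l * v ∈ Set.Ici 0 from hz), hrs]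
  refine (powerMean_mul_rpow_le (neg_inv_le_of_add hγ) hl _ _ hr0 hu hv).trans ?_
  gcongr
  refine (hfgh _ huA _ hvB).trans (le_of_eq ?_)
  congr 1
  rw [hrq]
  exact congrArg ENNReal.toNNReal (powerMean_ofReal_rpow hl' hr0 hu hv)

/-- Under `x = e^u` the geometric mean becomes arithmetic and the Jacobian `e^u` is multiplicative
for `M_0`. As `M_0 ≤ M_γ`, the inequality on `ℝ` with `δ = 0`, a fixed point of every shift,
applies. -/
theorem borell_brascamp_lieb_nnreal_zero {γ : EReal} (hγ : 0 ≤ γ) {l : ℝ}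
    (hl : l ∈ Set.Ioo (0 : ℝ) 1)
    {f g h : ℝ≥0 → ℝ≥0∞} (hf : Measurable f) (hg : Measurable g) (hh : Measurable h)
    {A B : Set ℝ≥0} (hfA : ∀ x, f x ≠ 0 → x ∈ A) (hgB : ∀ y, g y ≠ 0 → y ∈ B)
    (hfgh : ∀ x ∈ A, ∀ y ∈ B, powerMean γ l (f x) (g y) ≤ h (powerMean 0 l x y).toNNReal) :
    powerMean 0 l (∫⁻ x, f x ∂halfLineVolume) (∫⁻ x, g x ∂halfLineVolume) ≤
      ∫⁻ x, h x ∂halfLineVolume := by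
  have hl' : l ∈ Set.Icc (0 : ℝ) 1 := ⟨hl.1.le, hl.2.le⟩
  rw [lintegral_nnreal_eq_exp f, lintegral_nnreal_eq_exp g, lintegral_nnreal_eq_exp h]
  have supp : ∀ {u : ℝ≥0 → ℝ≥0∞} {D : Set ℝ≥0}, (∀ x, u x ≠ 0 → x ∈ D) → ∀ x : ℝ,
      ENNReal.ofReal (Real.exp x) * u (Real.exp x).toNNReal ≠ 0 →
      x ∈ {t : ℝ | (Real.exp t).toNNReal ∈ D} := fun huD x hx =>
    huD _ (right_ne_zero_of_mul hx)
  have empty : ∀ {u : ℝ≥0 → ℝ≥0∞} {D : Set ℝ≥0}, (∀ x, u x ≠ 0 → x ∈ D) →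
      {t : ℝ | (Real.exp t).toNNReal ∈ D} = ∅ →
      ∫⁻ x, ENNReal.ofReal (Real.exp x) * u (Real.exp x).toNNReal = 0 := by
    intro u D huD hD
    rw [← lintegral_zero (μ := (volume : Measure ℝ))]
    refine lintegral_congr fun x => ?_
    by_contra hx
    have := supp huD x hx
    rw [hD] at this
    exact this
  -- The substitution misses `0`. If nothing of `A` remains, the integral of `f` is zero and so is
  -- the geometric mean.
  rcases Set.eq_empty_or_nonempty {t : ℝ | (Real.exp t).toNNReal ∈ A} with hA | hA
  · rw [empty hfA hA, powerMean_zero_left le_rfl hl]; exact zero_le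
  rcases Set.eq_empty_or_nonempty {t : ℝ | (Real.exp t).toNNReal ∈ B} with hB | hB
  · rw [empty hgB hB, powerMean_zero_right le_rfl hl]; exact zero_le
  have main := borell_brascamp_lieb_real (δ := 0) (by simp) hl
    (f := fun x => ENNReal.ofReal (Real.exp x) * f (Real.exp x).toNNReal)
    (g := fun x => ENNReal.ofReal (Real.exp x) * g (Real.exp x).toNNReal)
    (h := fun x => ENNReal.ofReal (Real.exp x) * h (Real.exp x).toNNReal)
    (by fun_prop) (by fun_prop) (by fun_prop) hA hB (supp hfA) (supp hgB) ?_
  · rwa [shiftExponent_zero_right] at main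
  intro u hu v hv
  rw [powerMean_zero, ENNReal.mul_rpow_of_nonneg _ _ (by linarith [hl.2]),
    ENNReal.mul_rpow_of_nonneg _ _ hl.1.le, mul_mul_mul_comm, ← powerMean_zero, ← powerMean_zero,
    powerMean_zero_ofReal_exp]
  gcongr
  refine (powerMean_zero_le hγ hl' _ _).trans ((hfgh _ hu _ hv).trans (le_of_eq ?_))
  congr 1
  exact congrArg ENNReal.toNNReal (powerMean_zero_ofReal_exp l u v)

/-- The one-dimensional Borell–Brascamp–Lieb inequality for the mean `M_q` on `[0,∞)`. -/
theorem borell_brascamp_lieb_nnreal {q : ℝ≥0} (hq : q ≤ 1) {γ : EReal}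
    (hγ : -((((q : ℝ≥0∞)⁻¹)⁻¹ : ℝ≥0∞) : EReal) ≤ γ) {l : ℝ} (hl : l ∈ Set.Ioo (0 : ℝ) 1)
    {f g h : ℝ≥0 → ℝ≥0∞} (hf : Measurable f) (hg : Measurable g) (hh : Measurable h)
    {A B : Set ℝ≥0} (hA : A.Nonempty) (hB : B.Nonempty)
    (hfA : ∀ x, f x ≠ 0 → x ∈ A) (hgB : ∀ y, g y ≠ 0 → y ∈ B)
    (hfgh : ∀ x ∈ A, ∀ y ∈ B, powerMean γ l (f x) (g y) ≤
      h (powerMean ((q : ℝ) : EReal) l x y).toNNReal) :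
    powerMean (shiftExponent (q : ℝ≥0∞)⁻¹ γ) l (∫⁻ x, f x ∂halfLineVolume) (∫⁻ x, g x ∂halfLineVolume) ≤
      ∫⁻ x, h x ∂halfLineVolume := by
  rcases eq_or_ne q 0 with rfl | hq0
  · have hγ0 : 0 ≤ γ := by simpa using hγ
    rw [ENNReal.coe_zero, ENNReal.inv_zero,
      shiftExponent_top_left (ne_of_gt (lt_of_lt_of_le EReal.bot_lt_zero hγ0))]
    exact borell_brascamp_lieb_nnreal_zero hγ0 hl hf hg hh hfA hgB (by simpa using hfgh)
  · exact borell_brascamp_lieb_nnreal_of_ne_zero hq0 hq hγ hl hf hg hh hA hB hfA hgB hfgh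

/-! ### Slicing and induction on the dimension -/

theorem orthantVolume_eq_pi (n : ℕ) : orthantVolume n = Measure.pi fun _ => halfLineVolume := by
  refine Measure.pi_eq (fun s hs => ?_) |>.symm
  rw [orthantVolume, (measurableEmbedding_orthant n).comap_apply]
  have : (fun (x : Fin n → ℝ≥0) (i : Fin n) => (x i : ℝ)) '' Set.univ.pi s =
      Set.univ.pi fun i => (fun x : ℝ≥0 => (x : ℝ)) '' s i := by
    ext z
    constructor
    · rintro ⟨x, hx, rfl⟩ i hi
      exact ⟨x i, hx i hi, rfl⟩
    · intro hz
      choose x hx hxz using fun i => hz i (Set.mem_univ i)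
      exact ⟨x, fun i _ => hx i, funext hxz⟩
  rw [this, volume_pi_pi]
  exact Finset.prod_congr rfl fun i _ => (measurableEmbedding_coe_nnreal.comap_apply _ _).symm

instance (n : ℕ) : SigmaFinite (orthantVolume n) := by
  rw [orthantVolume_eq_pi]
  infer_instance

theorem lintegral_orthant_zero {f : (Fin 0 → ℝ≥0) → ℝ≥0∞} (z : Fin 0 → ℝ≥0) :
    ∫⁻ x, f x ∂orthantVolume 0 = f z := by
  rw [orthantVolume_eq_pi, Measure.pi_of_empty _ z, lintegral_dirac]

theorem measurable_fin_cons (n : ℕ) :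
    Measurable fun z : ℝ≥0 × (Fin n → ℝ≥0) => (Fin.cons z.1 z.2 : Fin (n + 1) → ℝ≥0) := by
  refine measurable_pi_iff.2 fun i => ?_
  refine Fin.cases ?_ (fun j => ?_) i
  · simpa using measurable_fst
  · simp only [Fin.cons_succ]
    fun_prop

theorem lintegral_orthant_succ {n : ℕ} {f : (Fin (n + 1) → ℝ≥0) → ℝ≥0∞} (hf : Measurable f) :
    ∫⁻ x, f x ∂orthantVolume (n + 1) =
      ∫⁻ t, ∫⁻ x, f (Fin.cons t x) ∂orthantVolume n ∂halfLineVolume := by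
  have mp := (measurePreserving_piFinSuccAbove (fun _ : Fin (n + 1) => halfLineVolume) 0).symm
  have e := mp.lintegral_comp hf
  rw [← orthantVolume_eq_pi, ← orthantVolume_eq_pi] at e
  rw [← e, ← lintegral_prod (fun z : ℝ≥0 × (Fin n → ℝ≥0) => f (Fin.cons z.1 z.2))
    (hf.comp (measurable_fin_cons n)).aemeasurable]
  simp [MeasurableEquiv.piFinSuccAbove, Fin.insertNthEquiv]

theorem vecMean_cons {n : ℕ} (p : Fin (n + 1) → ℝ≥0) (l : ℝ) (s t : ℝ≥0) (x y : Fin n → ℝ≥0) :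
    vecMean p l (Fin.cons s x) (Fin.cons t y) =
      Fin.cons (powerMean ((p 0 : ℝ) : EReal) l s t).toNNReal
        (vecMean (fun i => p i.succ) l x y) := by
  funext i
  refine Fin.cases ?_ (fun j => ?_) i <;> simp [vecMean]

/-- The Borell–Brascamp–Lieb inequality for the means `M_p` on `[0,∞)ⁿ`, for weights in `(0,1)` and
measurable functions. The hypothesis is required on a product `A × B` of nonempty sets outside of
which `f` and `g` vanish. -/
theorem borell_brascamp_lieb_orthant {n : ℕ} (p : Fin n → ℝ≥0) (hp : ∀ i, p i ≤ 1) {γ : EReal}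
    (hγ : -(((sumInv p)⁻¹ : ℝ≥0∞) : EReal) ≤ γ) {l : ℝ} (hl : l ∈ Set.Ioo (0 : ℝ) 1)
    {f g h : (Fin n → ℝ≥0) → ℝ≥0∞} (hf : Measurable f) (hg : Measurable g) (hh : Measurable h)
    {A B : Set (Fin n → ℝ≥0)} (hA : A.Nonempty) (hB : B.Nonempty)
    (hfA : ∀ x, f x ≠ 0 → x ∈ A) (hgB : ∀ y, g y ≠ 0 → y ∈ B)
    (hfgh : ∀ x ∈ A, ∀ y ∈ B, powerMean γ l (f x) (g y) ≤ h (vecMean p l x y)) :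
    powerMean (shiftExponent (sumInv p) γ) l (∫⁻ x, f x ∂orthantVolume n)
      (∫⁻ x, g x ∂orthantVolume n) ≤ ∫⁻ x, h x ∂orthantVolume n := by
  induction n generalizing γ with
  | zero =>
    obtain ⟨x, hx⟩ := hA
    obtain ⟨y, hy⟩ := hB
    rw [lintegral_orthant_zero x, lintegral_orthant_zero y,
      lintegral_orthant_zero (vecMean p l x y)]
    simpa [sumInv, shiftExponent_zero_left] using hfgh x hx y hy
  | succ n ih =>
    have hS : sumInv p = (p 0 : ℝ≥0∞)⁻¹ + sumInv fun i => p i.succ := Fin.sum_univ_succ _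
    rw [hS] at hγ
    obtain ⟨hδ, hcomp⟩ := shiftExponent_add hγ
    have meas : ∀ {u : (Fin (n + 1) → ℝ≥0) → ℝ≥0∞}, Measurable u →
        Measurable fun t => ∫⁻ x, u (Fin.cons t x) ∂orthantVolume n := fun hu =>
      Measurable.lintegral_prod_right' (hu.comp (measurable_fin_cons n))
    have slice : ∀ {u : (Fin (n + 1) → ℝ≥0) → ℝ≥0∞}, Measurable u → ∀ t,
        Measurable fun x : Fin n → ℝ≥0 => u (Fin.cons t x) := fun hu t =>
      (hu.comp (measurable_fin_cons n)).comp measurable_prodMk_left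
    have proj : ∀ {D : Set (Fin (n + 1) → ℝ≥0)}, D.Nonempty →
        {t | {x : Fin n → ℝ≥0 | Fin.cons t x ∈ D}.Nonempty}.Nonempty := fun ⟨x, hx⟩ =>
      ⟨x 0, Fin.tail x, by rwa [Set.mem_ofPred_eq, Fin.cons_self_tail]⟩
    have supp : ∀ {u : (Fin (n + 1) → ℝ≥0) → ℝ≥0∞} {D : Set (Fin (n + 1) → ℝ≥0)},
        (∀ x, u x ≠ 0 → x ∈ D) → ∀ t, ∫⁻ x, u (Fin.cons t x) ∂orthantVolume n ≠ 0 →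
        t ∈ {t | {x : Fin n → ℝ≥0 | Fin.cons t x ∈ D}.Nonempty} := by
      intro u D huD t ht
      by_contra hne
      apply ht
      rw [← lintegral_zero (μ := orthantVolume n)]
      refine lintegral_congr fun x => ?_
      by_contra hx
      exact hne ⟨x, huD _ hx⟩
    rw [hS, ← hcomp, lintegral_orthant_succ hf, lintegral_orthant_succ hg,
      lintegral_orthant_succ hh]
    -- The line inequality acts on the slice integrals, with the projections of `A` and `B` as
    -- supporting sets; the induction hypothesis supplies its pointwise assumption.
    refine borell_brascamp_lieb_nnreal (hp 0) hδ hl (meas hf) (meas hg) (meas hh) (proj hA)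
      (proj hB) (supp hfA) (supp hgB) fun s hs t ht => ?_
    refine ih (fun i => p i.succ) (fun i => hp i.succ) (neg_inv_le_of_add hγ) (slice hf s)
      (slice hg t) (slice hh _) hs ht (fun x hx => hfA _ hx) (fun y hy => hgB _ hy)
      fun x hx y hy => ?_
    rw [← vecMean_cons]
    exact hfgh _ hx _ hy

/-! ### Reduction to measurable functions, endpoint weights, and the theorem -/

/-- An almost everywhere measurable function has a measurable majorant with the same integral. -/
theorem AEMeasurable.exists_measurable_ge_lintegral_eq {α : Type*} [MeasurableSpace α]
    {μ : Measure α} {f : α → ℝ≥0∞} (hf : AEMeasurable f μ) :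
    ∃ g, Measurable g ∧ f ≤ g ∧ ∫⁻ x, g x ∂μ = ∫⁻ x, f x ∂μ := by
  set N := toMeasurable μ {x | f x ≠ hf.mk f x}
  have hN : μ N = 0 := by
    rw [measure_toMeasurable]
    exact hf.ae_eq_mk
  have hNm : MeasurableSet N := measurableSet_toMeasurable _ _
  refine ⟨fun x => hf.mk f x + N.indicator (fun _ => ⊤) x,
    hf.measurable_mk.add (measurable_const.indicator hNm), fun x => ?_, ?_⟩
  · by_cases hx : x ∈ N
    · simp [hx]
    · have : f x = hf.mk f x := by
        by_contra h
        exact hx (subset_toMeasurable _ _ h)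
      simp [hx, this]
  · rw [lintegral_add_left hf.measurable_mk, lintegral_indicator hNm, setLIntegral_const, hN,
      mul_zero, add_zero]
    exact lintegral_congr_ae hf.ae_eq_mk.symm

theorem powerMean_weight_zero {s : EReal} (h1 : s ≠ ⊥) (h2 : s ≠ ⊤) (a b : ℝ≥0∞) :
    powerMean s 0 a b = a := by
  induction s with
  | bot => exact absurd rfl h1
  | top => exact absurd rfl h2
  | coe r =>
    rcases eq_or_ne r 0 with rfl | hr
    · simp [powerMean_zero]
    · simp [powerMean_coe hr, ← ENNReal.rpow_mul, hr]

theorem powerMean_weight_one {s : EReal} (h1 : s ≠ ⊥) (h2 : s ≠ ⊤) (a b : ℝ≥0∞) :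
    powerMean s 1 a b = b := by
  induction s with
  | bot => exact absurd rfl h1
  | top => exact absurd rfl h2
  | coe r =>
    rcases eq_or_ne r 0 with rfl | hr
    · simp [powerMean_zero]
    · simp [powerMean_coe hr, ← ENNReal.rpow_mul, hr]

theorem vecMean_weight_zero {n : ℕ} (p : Fin n → ℝ≥0) (x y : Fin n → ℝ≥0) :
    vecMean p 0 x y = x := by
  funext i
  simp [vecMean, powerMean_weight_zero]

theorem vecMean_weight_one {n : ℕ} (p : Fin n → ℝ≥0) (x y : Fin n → ℝ≥0) :
    vecMean p 1 x y = y := by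
  funext i
  simp [vecMean, powerMean_weight_one]

theorem combinedExponent_ne_top (S : ℝ≥0∞) (γ : EReal) : combinedExponent S γ ≠ ⊤ := by
  unfold combinedExponent
  split_ifs
  · simp
  · simp
  · exact (EReal.inv_lt_top _).ne

theorem powerMean_weight_zero_le {s : EReal} (hs : s ≠ ⊤) (a b : ℝ≥0∞) :
    powerMean s 0 a b ≤ a := by
  rcases eq_or_ne s ⊥ with rfl | h
  · rw [powerMean_bot]; exact min_le_left _ _
  · rw [powerMean_weight_zero h hs]

theorem powerMean_weight_one_le {s : EReal} (hs : s ≠ ⊤) (a b : ℝ≥0∞) :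
    powerMean s 1 a b ≤ b := by
  rcases eq_or_ne s ⊥ with rfl | h
  · rw [powerMean_bot]; exact min_le_right _ _
  · rw [powerMean_weight_one h hs]

theorem le_powerMean_weight_zero {s : EReal} (hs : s ≠ ⊥) (a b : ℝ≥0∞) :
    a ≤ powerMean s 0 a b := by
  rcases eq_or_ne s ⊤ with rfl | h
  · rw [powerMean_top]; exact le_max_left _ _
  · rw [powerMean_weight_zero hs h]

theorem le_powerMean_weight_one {s : EReal} (hs : s ≠ ⊥) (a b : ℝ≥0∞) :
    b ≤ powerMean s 1 a b := by
  rcases eq_or_ne s ⊤ with rfl | h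
  · rw [powerMean_top]; exact le_max_right _ _
  · rw [powerMean_weight_one hs h]

theorem one_le_sumInv {n : ℕ} (hn : 0 < n) {p : Fin n → ℝ≥0} (hp : ∀ i, p i ≤ 1) :
    1 ≤ sumInv p := by
  refine le_trans ?_ (Finset.single_le_sum (f := fun i => (p i : ℝ≥0∞)⁻¹) (fun _ _ => zero_le)
    (Finset.mem_univ (⟨0, hn⟩ : Fin n)))
  exact ENNReal.one_le_inv.2 (by exact_mod_cast hp _)

theorem corollary1p5 {n : ℕ} (hn : 0 < n)
    (p : Fin n → ℝ≥0) (hp : ∀ i, p i ≤ 1)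
    (γ : EReal) (hγ : -(((sumInv p)⁻¹ : ℝ≥0∞) : EReal) ≤ γ)
    (l : ℝ) (hl : l ∈ Set.Icc (0 : ℝ) 1)
    (f g h : (Fin n → ℝ≥0) → ℝ≥0)
    (hf : AEMeasurable f (orthantVolume n)) (hg : AEMeasurable g (orthantVolume n))
    (hh : AEMeasurable h (orthantVolume n))
    (hf0 : (Function.support f).Nonempty) (hg0 : (Function.support g).Nonempty)
    (hfgh : ∀ x ∈ Function.support f, ∀ y ∈ Function.support g,
      powerMean γ l (f x) (g y) ≤ (h (vecMean p l x y) : ℝ≥0∞)) :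
    powerMean (combinedExponent (sumInv p) γ) l
        (∫⁻ x, (f x : ℝ≥0∞) ∂(orthantVolume n)) (∫⁻ x, (g x : ℝ≥0∞) ∂(orthantVolume n))
      ≤ ∫⁻ x, (h x : ℝ≥0∞) ∂(orthantVolume n) := by
  have hS : sumInv p ≠ 0 := (zero_lt_one.trans_le (one_le_sumInv hn hp)).ne'
  have hγ0 : γ ≠ ⊥ := by
    rintro rfl
    simp [hS] at hγ
  rcases hl.1.eq_or_lt with rfl | hl0
  -- For `l = 0` the vector mean is `x`, so `f ≤ h` pointwise once some `y` with `g y ≠ 0` is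
  -- chosen; `l = 1` is symmetric.
  · refine (powerMean_weight_zero_le (combinedExponent_ne_top _ _) _ _).trans
      (lintegral_mono fun x => ?_)
    by_cases hx : f x = 0
    · simp [hx]
    · obtain ⟨y, hy⟩ := hg0
      have := hfgh x hx y hy
      rw [vecMean_weight_zero] at this
      exact (le_powerMean_weight_zero hγ0 _ _).trans this
  rcases hl.2.eq_or_lt with rfl | hl1
  · refine (powerMean_weight_one_le (combinedExponent_ne_top _ _) _ _).trans
      (lintegral_mono fun y => ?_)
    by_cases hy : g y = 0
    · simp [hy]
    · obtain ⟨x, hx⟩ := hf0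
      have := hfgh x hx y hy
      rw [vecMean_weight_one] at this
      exact (le_powerMean_weight_one hγ0 _ _).trans this
  -- Shrinking `f`, `g` and enlarging `h` preserves the hypothesis on the original supports, which
  -- remain the sets `A` and `B`.
  obtain ⟨f', hf'm, hf'f, hf'⟩ :=
    exists_measurable_le_lintegral_eq (orthantVolume n) fun x => (f x : ℝ≥0∞)
  obtain ⟨g', hg'm, hg'g, hg'⟩ :=
    exists_measurable_le_lintegral_eq (orthantVolume n) fun x => (g x : ℝ≥0∞)
  obtain ⟨h', hh'm, hh'h, hh'⟩ := hh.coe_nnreal_ennreal.exists_measurable_ge_lintegral_eq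
  rw [combinedExponent_eq hS hγ, hf', hg', ← hh']
  refine borell_brascamp_lieb_orthant p hp hγ ⟨hl0, hl1⟩ hf'm hg'm hh'm hf0 hg0
    (fun x hx h0 => hx ?_) (fun y hy h0 => hy ?_) fun x hx y hy => ?_
  · exact le_antisymm ((hf'f x).trans (by simp [h0])) zero_le
  · exact le_antisymm ((hg'g y).trans (by simp [h0])) zero_le
  · exact (powerMean_mono γ hl (hf'f x) (hg'g y)).trans ((hfgh x hx y hy).trans (hh'h _))
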